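/- Let $a>0$ and $\alpha_i,\beta_i\ge 0$ with $\alpha_i+\beta_i=1$ ($i=1,2$) and $\beta_1+\beta_2>0$. Let $K_1:L^1((-1,0);dv)\to L^1((0,1);dv)$ and $K_2:L^1((0,1);dv)\to L^1((-1,0);dv)$ be compact stochastic operators on complex $L^1$ spaces (stochastic: positive, and norm preserving on the positive cone), and denote by $k_i$ the kernel of $K_i$, i.e. $(K_if)(v)=\int k_i(v,v')f(v')\,dv'$. Let $R_1:L^1(-1,0)\to L^1(0,1)$ and $R_2:L^1(0,1)\to L^1(-1,0)$ be the reflections $(R_i\varphi)(v)=\varphi(-v)$, put $O_i=\alpha_iR_i+\beta_iK_i$, and for $\operatorname{Re}\lambda\ge 0$ let $$G_\lambda=O_1\,e^{-2\lambda a/|v|}\,O_2\,e^{-2\lambda a/|v|}:\ L^1((0,1);dv)\to L^1((0,1);dv),$$ where $e^{-2\lambda a/|v|}$ and $|v|^{-2}$ stand for the operators of multiplication by these functions. All $\lambda$ below satisfy $\operatorname{Re}\lambda\ge 0$. (i) Let $\beta_1>0$ and $\beta_2>0$. If $k_1(v'',\cdot)\in L^\infty(-1,0)$ for almost all $v''\in(0,1)$,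 then $\sup_{|\lambda|\ge\eta}\|G_\lambda\|<1$ for every $\eta>0$. If $k_1$ and $k_2$ are continuous on $(0,1)\times(-1,0)$ and $(-1,0)\times(0,1)$ respectively, and $K_1|v|^{-2}K_2$ is bounded (on all of $L^1(0,1)$), then there is $\hat c>0$ such that $\|G_\lambda\|\le 1-\hat c\,|\operatorname{Im}\lambda|^2$ for all $\lambda$ sufficiently close to $0$. (ii) Let $\beta_1>0$ and $\beta_2=0$. If $k_1(v'',\cdot)\in L^\infty(-1,0)$ for almost all $v''\in(0,1)$, then $\sup_{|\lambda|\ge\eta}\|G_\lambda^2\|<1$ for every $\eta>0$. If $k_1$ is continuous on $(0,1)\times(-1,0)$ and $K_1|v|^{-2}R_2K_1$ is bounded, then there is $\hat c>0$ such that $\|G_\lambda^2\|\le 1-\hat c\,|\operatorname{Im}\lambda|^2$ for all $\lambda$ sufficiently close to $0$. (ii') Let $\beta_1=0$ and $\beta_2>0$. If $k_2(v'',\cdot)\in L^\infty(0,1)$ for almost all $v''\in(-1,0)$, then $\sup_{|\lambda|\ge\eta}\|G_\lambda^2\|<1$ for every $\eta>0$. If $k_2$ is continuous on $(-1,0)\times(0,1)$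 and $K_2|v|^{-2}R_1K_2$ is bounded, then there is $\hat c>0$ such that $\|G_\lambda^2\|\le 1-\hat c\,|\operatorname{Im}\lambda|^2$ for all $\lambda$ sufficiently close to $0$. (iii) In each of the three cases: under the first ($L^\infty$) assumption, $1-G_\lambda$ is invertible for all $\lambda\ne0$ and $\sup_{|\lambda|\ge\eta}\|(1-G_\lambda)^{-1}\|<\infty$ for every $\eta>0$; under the second (continuity and boundedness) assumption, $1-G_\lambda$ is invertible for all $\lambda\neq 0$ close to $0$, and there is $C$ such that $\|(1-G_\lambda)^{-1}\|\le C\,|\operatorname{Im}\lambda|^{-2}$ for all such $\lambda$ with $\operatorname{Im}\lambda\ne0$. -/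

import Mathlib

open MeasureTheory Filter Topology

noncomputable section

namespace SlabTransport

/-- Lebesgue measure on the interval `(0, 1)` of incoming directions at the left wall. -/
abbrev μPos : Measure ℝ := volume.restrict (Set.Ioo (0 : ℝ) 1)

/-- Lebesgue measure on the interval `(-1, 0)`. -/
abbrev μNeg : Measure ℝ := volume.restrict (Set.Ioo (-1 : ℝ) 0)

/-- The complex Banach space `L¹((0,1); dv)`. -/
abbrev L1Pos : Type := Lp ℂ 1 μPos

/-- The complex Banach space `L¹((-1,0); dv)`. -/
abbrev L1Neg : Type := Lp ℂ 1 μNeg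

/-- `f ≥ 0` almost everywhere (in particular `f` is real valued). -/
def IsNonneg {μ : Measure ℝ} (f : Lp ℂ 1 μ) : Prop :=
  ∀ᵐ v ∂μ, 0 ≤ (f v).re ∧ (f v).im = 0

/-- A stochastic operator: positive, and norm preserving on the positive cone. -/
def IsStochastic {μ ν : Measure ℝ} (K : Lp ℂ 1 μ →L[ℂ] Lp ℂ 1 ν) : Prop :=
  ∀ f : Lp ℂ 1 μ, IsNonneg f → IsNonneg (K f) ∧ ‖K f‖ = ‖f‖

/-- `k` is a (measurable) kernel of the operator `K`:
`(K f)(v) = ∫ k(v, v') f(v') dv'` for almost all `v`, the integral being absolutely convergent. -/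
def IsKernelOf {μ ν : Measure ℝ} (k : ℝ → ℝ → ℝ) (K : Lp ℂ 1 μ →L[ℂ] Lp ℂ 1 ν) : Prop :=
  AEStronglyMeasurable (Function.uncurry k) (ν.prod μ) ∧
    ∀ f : Lp ℂ 1 μ, ∀ᵐ v ∂ν,
      Integrable (fun v' => (k v v' : ℂ) * f v') μ ∧ K f v = ∫ v', (k v v' : ℂ) * f v' ∂μ

theorem measurePreserving_neg_pos : MeasurePreserving (fun v : ℝ => -v) μPos μNeg := by
  have h := (Measure.measurePreserving_neg (volume : Measure ℝ)).restrict_preimage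
    (measurableSet_Ioo : MeasurableSet (Set.Ioo (-1 : ℝ) 0))
  have e : (Neg.neg : ℝ → ℝ) ⁻¹' Set.Ioo (-1 : ℝ) 0 = Set.Ioo 0 1 := by
    ext v
    simp only [Set.mem_preimage, Set.mem_Ioo]
    constructor <;> rintro ⟨h1, h2⟩ <;> constructor <;> linarith
  rw [e] at h
  exact h

theorem measurePreserving_neg_neg : MeasurePreserving (fun v : ℝ => -v) μNeg μPos := by
  have h := (Measure.measurePreserving_neg (volume : Measure ℝ)).restrict_preimage
    (measurableSet_Ioo : MeasurableSet (Set.Ioo (0 : ℝ) 1))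
  have e : (Neg.neg : ℝ → ℝ) ⁻¹' Set.Ioo (0 : ℝ) 1 = Set.Ioo (-1) 0 := by
    ext v
    simp only [Set.mem_preimage, Set.mem_Ioo]
    constructor <;> rintro ⟨h1, h2⟩ <;> constructor <;> linarith
  rw [e] at h
  exact h

/-- The specular reflection `(R₁ φ)(v) = φ(-v)`, `L¹(-1,0) → L¹(0,1)`. -/
def R₁ : L1Neg →L[ℂ] L1Pos :=
  (Lp.compMeasurePreservingₗᵢ ℂ (fun v : ℝ => -v) measurePreserving_neg_pos).toContinuousLinearMap

/-- The specular reflection `(R₂ φ)(v) = φ(-v)`, `L¹(0,1) → L¹(-1,0)`. -/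
def R₂ : L1Pos →L[ℂ] L1Neg :=
  (Lp.compMeasurePreservingₗᵢ ℂ (fun v : ℝ => -v) measurePreserving_neg_neg).toContinuousLinearMap

theorem R₁_apply (f : L1Neg) : ∀ᵐ v ∂μPos, R₁ f v = f (-v) :=
  Lp.coeFn_compMeasurePreserving f measurePreserving_neg_pos

theorem R₂_apply (f : L1Pos) : ∀ᵐ v ∂μNeg, R₂ f v = f (-v) :=
  Lp.coeFn_compMeasurePreserving f measurePreserving_neg_neg

/-- The function `v ↦ exp (-2 z a / |v|)`. -/
def expFactor (a : ℝ) (z : ℂ) (v : ℝ) : ℂ := Complex.exp (-(2 * z * (a : ℂ)) / ((|v| : ℝ) : ℂ))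

theorem norm_expFactor_le {a : ℝ} (ha : 0 ≤ a) {z : ℂ} (hz : 0 ≤ z.re) (v : ℝ) :
    ‖expFactor a z v‖ ≤ 1 := by
  rw [expFactor, Complex.norm_exp, Real.exp_le_one_iff, Complex.div_ofReal_re]
  apply div_nonpos_of_nonpos_of_nonneg _ (abs_nonneg v)
  have : (-(2 * z * (a : ℂ))).re = -(2 * z.re * a) := by simp
  rw [this]
  have := mul_nonneg hz ha
  linarith

theorem memLp_expFactor {a : ℝ} (ha : 0 ≤ a) {z : ℂ} (hz : 0 ≤ z.re) (μ : Measure ℝ) :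
    MemLp (expFactor a z) ⊤ μ := by
  refine memLp_top_of_bound ?_ 1 (Eventually.of_forall (norm_expFactor_le ha hz))
  unfold expFactor
  exact Measurable.aestronglyMeasurable (by fun_prop)

open Classical in
/-- The bounded operator on `L¹(μ)` of multiplication by `v ↦ exp (-2 z a / |v|)`. It is only used
for `a > 0` and `0 ≤ z.re`, when this function is bounded (otherwise the value is irrelevant). -/
def expMul (a : ℝ) (z : ℂ) (μ : Measure ℝ) : Lp ℂ 1 μ →L[ℂ] Lp ℂ 1 μ :=
  if h : MemLp (expFactor a z) ⊤ μ then
    (ContinuousLinearMap.mul ℂ ℂ).holderL μ ⊤ 1 1 h.toLp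
  else 0

theorem expMul_apply {a : ℝ} (ha : 0 ≤ a) {z : ℂ} (hz : 0 ≤ z.re) {μ : Measure ℝ}
    (f : Lp ℂ 1 μ) : ∀ᵐ v ∂μ, expMul a z μ f v = expFactor a z v * f v := by
  have h := memLp_expFactor ha hz μ
  rw [expMul, dif_pos h]
  filter_upwards [(ContinuousLinearMap.mul ℂ ℂ).coeFn_holder (r := 1) h.toLp f,
    h.coeFn_toLp] with v h1 h2
  rw [← h2]
  exact h1

/-- The boundary operator `O₁ = α₁ R₁ + β₁ K₁`. -/
def O₁ (α₁ β₁ : ℝ) (K₁ : L1Neg →L[ℂ] L1Pos) : L1Neg →L[ℂ] L1Pos :=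
  (α₁ : ℂ) • R₁ + (β₁ : ℂ) • K₁

/-- The boundary operator `O₂ = α₂ R₂ + β₂ K₂`. -/
def O₂ (α₂ β₂ : ℝ) (K₂ : L1Pos →L[ℂ] L1Neg) : L1Pos →L[ℂ] L1Neg :=
  (α₂ : ℂ) • R₂ + (β₂ : ℂ) • K₂

/-- The operator `G_z f = A (e^{-2za/|v|} B (e^{-2za/|v|} f))` on `L¹(0,1)`, where `A = O₁` and
`B = O₂` are the boundary operators. -/
def G (a : ℝ) (A : L1Neg →L[ℂ] L1Pos) (B : L1Pos →L[ℂ] L1Neg) (z : ℂ) : L1Pos →L[ℂ] L1Pos :=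
  A ∘L expMul a z μNeg ∘L B ∘L expMul a z μPos

/-- The operator `A |v|⁻² B` is everywhere defined and bounded: `|v|⁻² (B f)` is in `L¹` for
every `f`, and `f ↦ A (|v|⁻² B f)` is a bounded operator. -/
def IsBoundedInvSq {μ ν ρ : Measure ℝ} (A : Lp ℂ 1 ν →L[ℂ] Lp ℂ 1 ρ)
    (B : Lp ℂ 1 μ →L[ℂ] Lp ℂ 1 ν) : Prop :=
  ∃ T : Lp ℂ 1 μ →L[ℂ] Lp ℂ 1 ρ, ∀ f : Lp ℂ 1 μ, ∃ g : Lp ℂ 1 ν,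
    (∀ᵐ v ∂ν, g v = (((|v| ^ 2)⁻¹ : ℝ) : ℂ) * B f v) ∧ T f = A g

/-- `sup {‖T z‖ : Re z ≥ 0, |z| ≥ η} < 1` for every `η > 0`. -/
def NormSupLtOne (T : ℂ → L1Pos →L[ℂ] L1Pos) : Prop :=
  ∀ η : ℝ, 0 < η → ∃ c : ℝ, c < 1 ∧ ∀ z : ℂ, 0 ≤ z.re → η ≤ ‖z‖ → ‖T z‖ ≤ c

/-- For some `c > 0`: `‖T z‖ ≤ 1 - c |Im z|²` for all `z` near `0` with `Re z ≥ 0`. -/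
def QuadraticBound (T : ℂ → L1Pos →L[ℂ] L1Pos) : Prop :=
  ∃ c : ℝ, 0 < c ∧ ∀ᶠ z in 𝓝[{z : ℂ | 0 ≤ z.re}] 0, ‖T z‖ ≤ 1 - c * |z.im| ^ 2

/-- For every `η > 0`, the operators `(1 - T z)⁻¹` exist and are uniformly bounded for
`Re z ≥ 0`, `|z| ≥ η`. -/
def ResolventBounded (T : ℂ → L1Pos →L[ℂ] L1Pos) : Prop :=
  ∀ η : ℝ, 0 < η → ∃ C : ℝ, ∀ z : ℂ, 0 ≤ z.re → η ≤ ‖z‖ →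
    IsUnit (1 - T z) ∧ ‖Ring.inverse (1 - T z)‖ ≤ C

/-- For `z ≠ 0` near `0` with `Re z ≥ 0`, `(1 - T z)⁻¹` exists and its norm is `O(|Im z|⁻²)`
(no bound is asserted where `Im z = 0`). -/
def ResolventQuadratic (T : ℂ → L1Pos →L[ℂ] L1Pos) : Prop :=
  ∃ C : ℝ, ∀ᶠ z in 𝓝[{z : ℂ | 0 ≤ z.re ∧ z ≠ 0}] 0,
    IsUnit (1 - T z) ∧ (z.im ≠ 0 → ‖Ring.inverse (1 - T z)‖ ≤ C / |z.im| ^ 2)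

end SlabTransport

end

namespace SlabTransport

/-! Everything reduces to the operator `K e^{-2za/|v|} H`, with `K` stochastic given by a kernel and
`H` stochastic and compact. For two partly diffuse walls, `G` expands into a convex combination of
contractions in which `K₁ e^{-2za/|v|} K₂` has weight `β₁ β₂`. If one wall is specular, a
diffuse-to-diffuse path needs two round trips: the reflection commutes with the even factor
`e^{-2za/|v|}`, so `G²` contains `K e^{-4za/|v|} R K` with weight `β²`. A gain in this one term is a
gain for the whole norm.

The gain comes from oscillation. On `L¹` it suffices to test on positive functions, and the damping
by `Re z` keeps them positive; what remains is, for almost every `v`, an integral of a nonnegative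
density `m(w) = k(v,w) g(w)` against the phase `e^{-2iya/|w|}`, `y = Im z`. Under `m` the travel
time `1/|w|` has an absolutely continuous law. Hence for `m ≠ 0` the modulus is strictly less than
the mass when `y ≠ 0` (`norm_apply_expMul_lt`), tends to zero as `|y| → ∞`
(`tendsto_apply_expMul_zero`), and loses at least a multiple of `y²` for small `y`, since `m`
charges two separated bands of travel times (`norm_apply_expMul_le_sub`, `exists_overlap_pos`).

Compactness of `H` makes this uniform: almost maximizing inputs `f n` have convergent images `H (f
n)`, so the estimates are needed only at, or near, a single limit density
(`exists_subseq_maximizing`). The resolvent bounds follow from `(1 - T)⁻¹ = (1 + T)(1 - T²)⁻¹`. -/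

/-! ### Positivity in `L¹`: operator norms and kernels. -/

theorem norm_add_of_disjoint {μ : Measure ℝ} {f g : ℝ → ℂ} (hf : MemLp f 1 μ) (hg : MemLp g 1 μ)
    (h : Disjoint (Function.support f) (Function.support g)) :
    ‖hf.toLp f + hg.toLp g‖ = ‖hf.toLp f‖ + ‖hg.toLp g‖ := by
  rw [← MemLp.toLp_add]
  simp only [L1.norm_eq_integral_norm]
  rw [← integral_add (L1.integrable_coeFn _).norm (L1.integrable_coeFn _).norm]
  refine integral_congr_ae ?_
  filter_upwards [hf.coeFn_toLp, hg.coeFn_toLp, (hf.add hg).coeFn_toLp] with v h1 h2 h3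
  rw [h1, h2, h3, Pi.add_apply]
  by_cases hv : f v = 0
  · simp [hv]
  · have : g v = 0 := by
      by_contra hg'
      exact Set.disjoint_left.1 h hv hg'
    simp [this]

/-- The norm of an operator on `L¹` is determined by its action on the positive cone. -/
theorem opNorm_le_of_nonneg {μ ν : Measure ℝ} (T : Lp ℂ 1 μ →L[ℂ] Lp ℂ 1 ν) {C : ℝ} (hC : 0 ≤ C)
    (h : ∀ f : Lp ℂ 1 μ, IsNonneg f → ‖f‖ = 1 → ‖T f‖ ≤ C) : ‖T‖ ≤ C := by
  have h' : ∀ f : Lp ℂ 1 μ, IsNonneg f → ‖T f‖ ≤ C * ‖f‖ := by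
    intro f hf
    by_cases h0 : f = 0
    · simp [h0]
    have hn : 0 < ‖f‖ := norm_pos_iff.2 h0
    have h1 := h ((‖f‖⁻¹ : ℝ) • f) ?_ ?_
    · have e : ((‖f‖⁻¹ : ℝ) • f) = ((‖f‖⁻¹ : ℝ) : ℂ) • f :=
        (Complex.coe_smul _ _).symm
      rw [e, map_smul, norm_smul, Complex.norm_real, norm_inv, norm_norm] at h1
      rwa [inv_mul_le_iff₀ hn, mul_comm] at h1
    · filter_upwards [hf, Lp.coeFn_smul (‖f‖⁻¹ : ℝ) f] with v h1 h2
      rw [h2, Pi.smul_apply]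
      simp only [Complex.real_smul, Complex.re_ofReal_mul, Complex.im_ofReal_mul, h1.2, mul_zero,
        and_true]
      exact mul_nonneg (inv_nonneg.2 hn.le) h1.1
    · rw [norm_smul, norm_inv, norm_norm, inv_mul_cancel₀ hn.ne']
  refine T.opNorm_le_bound hC fun f => ?_
  -- By density, simple functions suffice. A complex multiple of an indicator reduces to a positive
  -- function, and the `L¹` norm is additive over disjoint supports, so the triangle inequality for
  -- `T` loses nothing.
  refine Lp.induction (by simp) (fun f => ‖T f‖ ≤ C * ‖f‖) ?_ ?_ ?_ f
  · intro c s hs hμs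
    have e : ((Lp.simpleFunc.indicatorConst 1 hs hμs.ne c : Lp.simpleFunc ℂ 1 μ) : Lp ℂ 1 μ) =
        c • indicatorConstLp 1 hs hμs.ne (1 : ℂ) := by
      rw [Lp.simpleFunc.coe_indicatorConst]
      refine Lp.ext ?_
      filter_upwards [Lp.coeFn_smul c (indicatorConstLp 1 hs hμs.ne (1 : ℂ)),
        indicatorConstLp_coeFn (p := 1) (hs := hs) (hμs := hμs.ne) (c := (1 : ℂ)),
        indicatorConstLp_coeFn (p := 1) (hs := hs) (hμs := hμs.ne) (c := c)] with v h1 h2 h3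
      rw [h1, Pi.smul_apply, h2, h3]
      by_cases hvs : v ∈ s <;> simp [hvs]
    rw [e, map_smul, norm_smul, norm_smul, mul_left_comm]
    gcongr
    refine h' _ ?_
    filter_upwards [indicatorConstLp_coeFn (p := 1) (hs := hs) (hμs := hμs.ne) (c := (1 : ℂ))]
      with v hv
    rw [hv]
    by_cases hvs : v ∈ s <;> simp [hvs]
  · intro f g hf hg hd h1 h2
    rw [map_add, norm_add_of_disjoint hf hg hd, mul_add]
    exact (norm_add_le _ _).trans (add_le_add h1 h2)
  · exact isClosed_le (by fun_prop) (by fun_prop)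

theorem IsStochastic.norm_le_one {μ ν : Measure ℝ} {K : Lp ℂ 1 μ →L[ℂ] Lp ℂ 1 ν}
    (hK : IsStochastic K) : ‖K‖ ≤ 1 :=
  opNorm_le_of_nonneg K zero_le_one fun f hf h1 => by rw [(hK f hf).2, h1]

theorem isClosed_isNonneg {μ : Measure ℝ} : IsClosed {f : Lp ℂ 1 μ | IsNonneg f} := by
  refine IsSeqClosed.isClosed fun f g hf hfg => ?_
  obtain ⟨ns, -, hns⟩ := (tendstoInMeasure_of_tendsto_Lp hfg).exists_seq_tendsto_ae
  have : ∀ᵐ v ∂μ, ∀ n, 0 ≤ (f n v).re ∧ (f n v).im = 0 := ae_all_iff.2 hf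
  filter_upwards [hns, this] with v h1 h2
  refine ⟨ge_of_tendsto' ((Complex.continuous_re.tendsto _).comp h1) fun n => (h2 _).1, ?_⟩
  refine tendsto_nhds_unique ((Complex.continuous_im.tendsto _).comp h1) ?_
  simp [Function.comp_def, h2]

theorem integrableOn_kernel {c d : ℝ} {ρ : Measure ℝ} {k : ℝ → ℝ → ℝ}
    {K : Lp ℂ 1 (volume.restrict (Set.Ioo c d)) →L[ℂ] Lp ℂ 1 ρ} (hk : IsKernelOf k K) :
    ∀ᵐ v ∂ρ, Integrable (k v) (volume.restrict (Set.Ioo c d)) := by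
  have h1 : MemLp (fun _ : ℝ => (1 : ℂ)) 1 (volume.restrict (Set.Ioo c d)) := memLp_const 1
  filter_upwards [hk.2 h1.toLp] with v hv
  have := hv.1.congr (g := fun w => (k v w : ℂ)) (by
    filter_upwards [h1.coeFn_toLp] with w hw
    rw [hw, mul_one])
  simpa using this.re

/-- The kernel of a positive operator is nonnegative. -/
theorem kernel_nonneg {c d : ℝ} {ρ : Measure ℝ} {k : ℝ → ℝ → ℝ}
    {K : Lp ℂ 1 (volume.restrict (Set.Ioo c d)) →L[ℂ] Lp ℂ 1 ρ} (hk : IsKernelOf k K)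
    (hK : IsStochastic K) :
    ∀ᵐ v ∂ρ, ∀ᵐ w ∂(volume.restrict (Set.Ioo c d)), 0 ≤ k v w := by
  set ν := volume.restrict (Set.Ioo c d) with hν
  -- Testing only on rational intervals leaves one null set of exceptional `v`. The primitive of `k
  -- v` is then increasing by continuity, and `k v` is its derivative almost everywhere.
  have hQ : ∀ p q : ℚ, ∀ᵐ v ∂ρ, 0 ≤ ∫ w in Set.Ioc (p : ℝ) q, k v w ∂ν := by
    intro p q
    have hne : ν (Set.Ioc (p : ℝ) q) ≠ ⊤ := measure_ne_top _ _
    have hind := indicatorConstLp_coeFn (p := 1) (hs := measurableSet_Ioc) (hμs := hne)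
      (c := (1 : ℂ))
    set f : Lp ℂ 1 ν := indicatorConstLp 1 measurableSet_Ioc hne (1 : ℂ)
    have hf : IsNonneg f := by
      filter_upwards [hind] with v hv
      rw [hv]
      by_cases hvs : v ∈ Set.Ioc (p : ℝ) q <;> simp [hvs]
    filter_upwards [(hK f hf).1, hk.2 f] with v h1 h2
    have e : ∫ w, (k v w : ℂ) * f w ∂ν = ((∫ w in Set.Ioc (p : ℝ) q, k v w ∂ν : ℝ) : ℂ) := by
      rw [← integral_indicator measurableSet_Ioc, ← integral_complex_ofReal]
      refine integral_congr_ae ?_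
      filter_upwards [hind] with w hw
      rw [hw]
      by_cases hvs : w ∈ Set.Ioc (p : ℝ) q <;> simp [hvs]
    rw [h2.2, e] at h1
    simpa using h1.1
  filter_upwards [integrableOn_kernel hk, ae_all_iff.2 fun p => ae_all_iff.2 (hQ p)] with v hi hv
  set F : ℝ → ℝ := (Set.Ioo c d).indicator (k v) with hF
  have hFi : Integrable F volume := (integrable_indicator_iff measurableSet_Ioo).2 hi
  have hcont : Continuous fun x => ∫ t in (0 : ℝ)..x, F t :=
    intervalIntegral.continuous_primitive (fun _ _ => hFi.intervalIntegrable) 0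
  have hrat : ∀ p q : ℚ, p ≤ q → (∫ t in (0 : ℝ)..p, F t) ≤ ∫ t in (0 : ℝ)..q, F t := by
    intro p q hpq
    have hpq' : (p : ℝ) ≤ q := by exact_mod_cast hpq
    rw [← sub_nonneg, intervalIntegral.integral_interval_sub_left hFi.intervalIntegrable
      hFi.intervalIntegrable, intervalIntegral.integral_of_le hpq', hF,
      integral_indicator measurableSet_Ioo, Measure.restrict_restrict measurableSet_Ioo,
      Set.inter_comm, ← Measure.restrict_restrict measurableSet_Ioc]
    exact hv p q
  have hmono : Monotone fun x => ∫ t in (0 : ℝ)..x, F t := by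
    intro x y hxy
    rcases hxy.eq_or_lt with rfl | hxy
    · exact le_rfl
    obtain ⟨u, -, hu, hut⟩ := Real.exists_seq_rat_strictAnti_tendsto x
    obtain ⟨u', -, hu', hut'⟩ := Real.exists_seq_rat_strictAnti_tendsto y
    refine le_of_tendsto_of_tendsto ((hcont.tendsto x).comp hut) ((hcont.tendsto y).comp hut') ?_
    filter_upwards [hut.eventually (gt_mem_nhds hxy)] with n hn
    refine hrat _ _ ?_
    exact_mod_cast (hn.trans (hu' n)).le
  rw [ae_restrict_iff' measurableSet_Ioo]
  filter_upwards [LocallyIntegrable.ae_hasDerivAt_integral hFi.locallyIntegrable] with w hw hwI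
  have h1 := (hw 0).deriv
  have h2 : F w = k v w := Set.indicator_of_mem hwI _
  rw [← h2, ← h1]
  exact hmono.deriv_nonneg

/-! ### Phases and oscillating integrals. -/

theorem expFactor_imag (a y w : ℝ) :
    expFactor a (y * Complex.I) w = Complex.exp (Complex.I * ((-(2 * y * a) / |w| : ℝ) : ℂ)) := by
  rw [expFactor]
  congr 1
  push_cast
  ring

theorem norm_expFactor_imag (a y w : ℝ) : ‖expFactor a (y * Complex.I) w‖ = 1 := by
  rw [expFactor_imag, mul_comm, Complex.norm_exp_ofReal_mul_I]

theorem measurable_expFactor (a : ℝ) (z : ℂ) : Measurable (expFactor a z) := by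
  unfold expFactor
  fun_prop

/-- Two phases agree only if the values of `1/|w|` differ by an integer multiple of `π/(ya)`, and
each value of `1/|w|` comes from at most two points. The point `w = 0` fits in, because `0⁻¹ = 0`.
-/
theorem countable_expFactor_eq {a y : ℝ} (ha : a ≠ 0) (hy : y ≠ 0) (u : ℂ) :
    {w | expFactor a (y * Complex.I) w = u}.Countable := by
  rcases Set.eq_empty_or_nonempty {w | expFactor a (y * Complex.I) w = u} with h | ⟨w₀, hw₀⟩
  · rw [h]; exact Set.countable_empty
  have hsub : {w | expFactor a (y * Complex.I) w = u} ⊆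
      ⋃ n : ℤ, {(|w₀|⁻¹ + n * (2 * Real.pi) / (-(2 * y * a)))⁻¹,
        -(|w₀|⁻¹ + n * (2 * Real.pi) / (-(2 * y * a)))⁻¹} := by
    intro w hw
    have h1 : expFactor a (y * Complex.I) w = expFactor a (y * Complex.I) w₀ := hw.trans hw₀.symm
    rw [expFactor_imag, expFactor_imag, Complex.exp_eq_exp_iff_exists_int] at h1
    obtain ⟨n, hn⟩ := h1
    have h2 : -(2 * y * a) / |w| = -(2 * y * a) / |w₀| + n * (2 * Real.pi) := by
      have h3 : Complex.I * ((-(2 * y * a) / |w| : ℝ) : ℂ) =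
          Complex.I * ((-(2 * y * a) / |w₀| + n * (2 * Real.pi) : ℝ) : ℂ) := by
        rw [hn]; push_cast; ring
      exact_mod_cast mul_left_cancel₀ Complex.I_ne_zero h3
    have h0 : -(2 * y * a) ≠ 0 := by simp [ha, hy]
    have h4 : |w|⁻¹ = |w₀|⁻¹ + n * (2 * Real.pi) / (-(2 * y * a)) := by
      rw [div_eq_mul_inv, div_eq_mul_inv] at h2
      rw [eq_comm, ← sub_eq_zero]
      have : -(2 * y * a) * (|w₀|⁻¹ + n * (2 * Real.pi) / (-(2 * y * a)) - |w|⁻¹) = 0 := by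
        rw [mul_sub, mul_add, mul_div_cancel₀ _ h0, h2, sub_self]
      exact (mul_eq_zero.1 this).resolve_left h0
    refine Set.mem_iUnion.2 ⟨n, ?_⟩
    rw [← h4, inv_inv]
    rcases abs_choice w with h | h <;> simp [h]
  refine Set.Countable.mono hsub (Set.countable_iUnion fun n => ?_)
  exact (Set.toFinite _).countable

/-- Maximal modulus direction of an oscillating integral. -/
theorem exists_norm_integral_eq {ν : Measure ℝ} {m : ℝ → ℝ} (hm : Integrable m ν)
    {e : ℝ → ℂ} (he : AEStronglyMeasurable e ν) (he1 : ∀ w, ‖e w‖ = 1) :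
    ∃ u : ℂ, ‖u‖ = 1 ∧ Integrable (fun w => m w * (‖e w - u‖ ^ 2 / 2)) ν ∧
      ‖∫ w, (m w : ℂ) * e w ∂ν‖ = ∫ w, m w ∂ν - ∫ w, m w * (‖e w - u‖ ^ 2 / 2) ∂ν := by
  set B := ∫ w, (m w : ℂ) * e w ∂ν with hB
  -- Take `u` to be the direction of the integral. On the unit circle `1 - Re (e ū) = ‖e - u‖² / 2`,
  -- which is the pointwise loss.
  obtain ⟨u, hu, huB⟩ : ∃ u : ℂ, ‖u‖ = 1 ∧ (‖B‖ : ℂ) = B * (starRingEnd ℂ) u := by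
    by_cases h0 : B = 0
    · exact ⟨1, by simp, by simp [h0]⟩
    · have hn : (‖B‖ : ℂ) ≠ 0 := by simpa using h0
      refine ⟨B / ‖B‖, by simp [h0], ?_⟩
      rw [map_div₀, Complex.conj_ofReal, mul_div_assoc', Complex.mul_conj, eq_div_iff hn,
        Complex.normSq_eq_norm_sq]
      push_cast
      ring
  have hkey : ∀ w, m w * (‖e w - u‖ ^ 2 / 2) =
      m w - ((m w : ℂ) * e w * (starRingEnd ℂ) u).re := by
    intro w
    have h1 : ‖e w - u‖ ^ 2 = 2 - 2 * (e w * (starRingEnd ℂ) u).re := by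
      rw [← Complex.normSq_eq_norm_sq, Complex.normSq_sub, Complex.normSq_eq_norm_sq,
        Complex.normSq_eq_norm_sq, hu, he1]
      ring
    rw [h1, mul_assoc, Complex.re_ofReal_mul]
    ring
  have hme : Integrable (fun w => (m w : ℂ) * e w) ν :=
    hm.ofReal.mul_bdd (c := 1) he (Eventually.of_forall fun w => (he1 w).le)
  have hmeu := hme.mul_const ((starRingEnd ℂ) u)
  refine ⟨u, hu, ?_, ?_⟩
  · simp only [hkey]
    exact hm.sub hmeu.re
  · simp only [hkey]
    have h2 : ∫ w, ((m w : ℂ) * e w * (starRingEnd ℂ) u).re ∂ν =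
        (∫ w, (m w : ℂ) * e w * (starRingEnd ℂ) u ∂ν).re := integral_re hmeu
    rw [integral_sub hm (by exact hmeu.re), h2, integral_mul_const, ← hB, ← huB, Complex.ofReal_re]
    ring

/-- Without loss, the phase must equal one constant `u` wherever `m > 0`, but every level set of the
phase is null. -/
theorem ae_eq_zero_of_norm_integral_eq {ν : Measure ℝ} {m : ℝ → ℝ} (hm : Integrable m ν)
    (hm0 : 0 ≤ᵐ[ν] m) {e : ℝ → ℂ} (he : AEStronglyMeasurable e ν) (he1 : ∀ w, ‖e w‖ = 1)
    (hnull : ∀ u : ℂ, ∀ᵐ w ∂ν, e w ≠ u)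
    (h : ∫ w, m w ∂ν ≤ ‖∫ w, (m w : ℂ) * e w ∂ν‖) : m =ᵐ[ν] 0 := by
  obtain ⟨u, -, hi, hu⟩ := exists_norm_integral_eq hm he he1
  have hnn : 0 ≤ᵐ[ν] fun w => m w * (‖e w - u‖ ^ 2 / 2) := by
    filter_upwards [hm0] with w hw
    exact mul_nonneg hw (by positivity)
  have h0 : ∫ w, m w * (‖e w - u‖ ^ 2 / 2) ∂ν = 0 :=
    le_antisymm (by linarith) (integral_nonneg_of_ae hnn)
  rw [integral_eq_zero_iff_of_nonneg_ae hnn hi] at h0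
  filter_upwards [h0, hnull u] with w h1 h2
  have : ‖e w - u‖ ^ 2 / 2 ≠ 0 := by
    have := norm_pos_iff.2 (sub_ne_zero.2 h2)
    positivity
  exact (mul_eq_zero.1 h1).resolve_right this

/-- If the phases on two sets are `δ` apart, an oscillating integral loses a fixed part of
the smaller of the two masses. -/
theorem norm_integral_le_sub_min {ν : Measure ℝ} {m : ℝ → ℝ} (hm : Integrable m ν)
    (hm0 : 0 ≤ᵐ[ν] m) {e : ℝ → ℂ} (he : AEStronglyMeasurable e ν) (he1 : ∀ w, ‖e w‖ = 1)
    {S₁ S₂ : Set ℝ} (hS₁ : MeasurableSet S₁) (hS₂ : MeasurableSet S₂) {δ : ℝ} (hδ : 0 ≤ δ)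
    (hsep : ∀ w ∈ S₁, ∀ w' ∈ S₂, δ ≤ ‖e w - e w'‖) :
    ‖∫ w, (m w : ℂ) * e w ∂ν‖ ≤
      ∫ w, m w ∂ν - δ ^ 2 / 8 * min (∫ w in S₁, m w ∂ν) (∫ w in S₂, m w ∂ν) := by
  obtain ⟨u, -, hi, hu⟩ := exists_norm_integral_eq hm he he1
  have hnn : 0 ≤ᵐ[ν] fun w => m w * (‖e w - u‖ ^ 2 / 2) := by
    filter_upwards [hm0] with w hw
    exact mul_nonneg hw (by positivity)
  have hmain : ∀ S : Set ℝ, MeasurableSet S → (∀ w ∈ S, δ / 2 ≤ ‖e w - u‖) →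
      δ ^ 2 / 8 * ∫ w in S, m w ∂ν ≤ ∫ w, m w * (‖e w - u‖ ^ 2 / 2) ∂ν := by
    intro S hS h
    refine le_trans ?_ (setIntegral_le_integral (s := S) hi hnn)
    rw [← integral_const_mul]
    refine setIntegral_mono_ae_restrict (hm.integrableOn.const_mul _) hi.integrableOn ?_
    filter_upwards [ae_restrict_of_ae hm0, ae_restrict_mem hS] with w h1 h2
    have h3 : δ ^ 2 / 8 ≤ ‖e w - u‖ ^ 2 / 2 := by
      have := pow_le_pow_left₀ (by positivity) (h w h2) 2
      linarith [this, (by ring : (δ / 2) ^ 2 = δ ^ 2 / 4)]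
    change δ ^ 2 / 8 * m w ≤ m w * (‖e w - u‖ ^ 2 / 2)
    rw [mul_comm]
    exact mul_le_mul_of_nonneg_left h3 h1
  rw [hu]
  refine sub_le_sub_left ?_ _
  -- The direction `u` cannot come within `δ/2` of the phases on both sets; the set it avoids loses
  -- the fraction `(δ/2)²/2 = δ²/8` of its mass.
  by_cases hc : ∀ w ∈ S₁, δ / 2 ≤ ‖e w - u‖
  · exact (mul_le_mul_of_nonneg_left (min_le_left _ _) (by positivity)).trans (hmain S₁ hS₁ hc)
  · push Not at hc
    obtain ⟨w, hw, hwu⟩ := hc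
    refine (mul_le_mul_of_nonneg_left (min_le_right _ _) (by positivity)).trans
      (hmain S₂ hS₂ fun w' hw' => ?_)
    have h1 := hsep w hw w' hw'
    have h2 : ‖e w - e w'‖ ≤ ‖e w - u‖ + ‖e w' - u‖ := by
      rw [← norm_sub_rev u (e w')]
      exact norm_sub_le_norm_sub_add_norm_sub _ _ _
    linarith

/-- The bands of directions whose travel times `1 / |w|` lie in `(r, s)`. -/
def band (r s : ℝ) : Set ℝ := {w | r < |w|⁻¹ ∧ |w|⁻¹ < s}

theorem measurableSet_band (r s : ℝ) : MeasurableSet (band r s) := by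
  unfold band
  measurability

/-- The angle between the phases is at least `2a|y|(s - r)`, and `hy` keeps it at most `π`. A chord
of angle `θ` has length `2 sin (θ/2) ≥ 2θ/π` by Jordan's inequality. -/
theorem expFactor_sep {a y r s t : ℝ} (ha : 0 < a) (hrs : r < s)
    (hy : 2 * a * t * |y| ≤ Real.pi) {w w' : ℝ} (hw : w ∈ band 0 r) (hw' : w' ∈ band s t) :
    4 / Real.pi * a * (s - r) * |y| ≤
      ‖expFactor a (y * Complex.I) w - expFactor a (y * Complex.I) w'‖ := by
  set x := -(2 * y * a) / |w|
  set x' := -(2 * y * a) / |w'|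
  have e1 : expFactor a (y * Complex.I) w - expFactor a (y * Complex.I) w' =
      Complex.exp (Complex.I * (x' : ℂ)) * (Complex.exp (Complex.I * ((x - x' : ℝ) : ℂ)) - 1) := by
    rw [expFactor_imag, expFactor_imag, mul_sub, ← Complex.exp_add, mul_one]
    congr 2
    rw [Complex.ofReal_sub]
    ring
  have hd : |x - x'| = 2 * a * |y| * (|w'|⁻¹ - |w|⁻¹) := by
    have : x - x' = 2 * a * y * (|w'|⁻¹ - |w|⁻¹) := by
      simp only [x, x', div_eq_mul_inv]
      ring
    rw [this, abs_mul, abs_mul, abs_of_pos (by positivity : 0 < 2 * a),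
      abs_of_pos (by linarith [hw.2, hw'.1] : 0 < |w'|⁻¹ - |w|⁻¹)]
  have hle : |x - x'| ≤ Real.pi := by
    rw [hd]
    refine le_trans ?_ hy
    rw [mul_right_comm _ t]
    exact mul_le_mul_of_nonneg_left (by linarith [hw.1, hw'.2]) (by positivity)
  have hsin : |Real.sin ((x - x') / 2)| = Real.sin (|x - x'| / 2) := by
    rw [Real.abs_sin_eq_sin_abs_of_abs_le_pi, abs_div, abs_two]
    rw [abs_div, abs_two]
    linarith [abs_nonneg (x - x'), Real.pi_pos]
  rw [e1, norm_mul, mul_comm Complex.I (x' : ℂ), Complex.norm_exp_ofReal_mul_I, one_mul,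
    Complex.norm_exp_I_mul_ofReal_sub_one, norm_mul, Real.norm_eq_abs, Real.norm_eq_abs, abs_two,
    hsin]
  have h1 := Real.mul_le_sin (x := |x - x'| / 2) (by positivity) (by linarith)
  have h2 : 2 * a * |y| * (s - r) ≤ |x - x'| := by
    rw [hd]
    exact mul_le_mul_of_nonneg_left (by linarith [hw.2, hw'.1]) (by positivity)
  have h3 : 2 / Real.pi * (2 * a * |y| * (s - r)) ≤ 2 / Real.pi * |x - x'| :=
    mul_le_mul_of_nonneg_left h2 (by positivity)
  calc 4 / Real.pi * a * (s - r) * |y| = 2 / Real.pi * (2 * a * |y| * (s - r)) := by ring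
    _ ≤ 2 / Real.pi * |x - x'| := h3
    _ = 2 * (2 / Real.pi * (|x - x'| / 2)) := by ring
    _ ≤ _ := by linarith

/-! ### The law of the travel time. -/

/-- Away from `0` the preimage is covered by images of `N` under the differentiable maps `x ↦ ±1/x`,
which preserve null sets. -/
theorem volume_preimage_inv_abs {N : Set ℝ} (hN : volume N = 0) :
    volume ((fun w : ℝ => |w|⁻¹) ⁻¹' N) = 0 := by
  have h1 : volume ((fun x : ℝ => x⁻¹) '' (N \ {0})) = 0 := by
    refine addHaar_image_eq_zero_of_differentiableOn_of_addHaar_eq_zero _ ?_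
      (measure_mono_null Set.sdiff_subset hN)
    intro x hx
    exact (differentiableAt_inv (by simpa using hx.2)).differentiableWithinAt
  have h2 : volume ((fun x : ℝ => -x⁻¹) '' (N \ {0})) = 0 := by
    refine addHaar_image_eq_zero_of_differentiableOn_of_addHaar_eq_zero _ ?_
      (measure_mono_null Set.sdiff_subset hN)
    intro x hx
    exact (differentiableAt_inv (by simpa using hx.2)).neg.differentiableWithinAt
  refine measure_mono_null (t := {0} ∪ ((fun x : ℝ => x⁻¹) '' (N \ {0}) ∪
    (fun x : ℝ => -x⁻¹) '' (N \ {0}))) ?_ ?_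
  · intro w hw
    by_cases h0 : w = 0
    · simp [h0]
    refine Or.inr ?_
    have hmem : |w|⁻¹ ∈ N \ {0} := ⟨hw, by simpa using h0⟩
    rcases abs_choice w with h | h
    · exact Or.inl ⟨_, hmem, by simp [h]⟩
    · exact Or.inr ⟨_, hmem, by simp [h]⟩
  · exact measure_union_null (by simp) (measure_union_null h1 h2)

/-- The distribution of the travel time `1 / |w|` under the density `m`. -/
noncomputable def timeMeasure (ν : Measure ℝ) (m : ℝ → ℝ) : Measure ℝ :=
  (ν.withDensity fun w => ENNReal.ofReal (m w)).map fun w => |w|⁻¹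

theorem timeMeasure_absolutelyContinuous {ν : Measure ℝ} (hν : ν ≪ volume) (m : ℝ → ℝ) :
    timeMeasure ν m ≪ volume := by
  refine Measure.AbsolutelyContinuous.mk fun N hN h0 => ?_
  rw [timeMeasure, Measure.map_apply (by fun_prop) hN]
  exact (withDensity_absolutelyContinuous _ _) (hν (volume_preimage_inv_abs h0))

theorem isFiniteMeasure_timeMeasure {ν : Measure ℝ} {m : ℝ → ℝ} (hm : Integrable m ν) :
    IsFiniteMeasure (timeMeasure ν m) := by
  have := isFiniteMeasure_withDensity_ofReal hm.2
  unfold timeMeasure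
  infer_instance

theorem integral_timeMeasure {ν : Measure ℝ} {m : ℝ → ℝ} (hm : Integrable m ν)
    (hm0 : 0 ≤ᵐ[ν] m) {F : ℝ → ℂ} (hF : Measurable F) :
    ∫ x, F x ∂(timeMeasure ν m) = ∫ w, (m w : ℂ) * F |w|⁻¹ ∂ν := by
  rw [timeMeasure, integral_map (by fun_prop) hF.aestronglyMeasurable,
    integral_withDensity_eq_integral_toReal_smul₀ hm.aemeasurable.ennreal_ofReal
      (Eventually.of_forall fun _ => ENNReal.ofReal_lt_top)]
  refine integral_congr_ae ?_
  filter_upwards [hm0] with w hw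
  rw [ENNReal.toReal_ofReal hw, Complex.real_smul]

/-- A Riemann-Lebesgue lemma for the phases `exp (-2 i y a / |w|)`. -/
theorem tendsto_integral_expFactor {ν : Measure ℝ} (hν : ν ≪ volume) {m : ℝ → ℝ}
    (hm : Integrable m ν) (hm0 : 0 ≤ᵐ[ν] m) {a : ℝ} (ha : a ≠ 0) :
    Tendsto (fun y : ℝ => ∫ w, (m w : ℂ) * expFactor a (y * Complex.I) w ∂ν) (cocompact ℝ)
      (𝓝 0) := by
  have := isFiniteMeasure_timeMeasure hm
  have hac := timeMeasure_absolutelyContinuous hν m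
  have hc : a / Real.pi ≠ 0 := div_ne_zero ha Real.pi_ne_zero
  -- Classical Riemann-Lebesgue for the Lebesgue density of the travel time. The Fourier character
  -- carries a `2π`, so the frequency is `ya/π`.
  have h1 := (Real.tendsto_integral_exp_smul_cocompact
    (fun x => ((((timeMeasure ν m).rnDeriv volume x).toReal : ℝ) : ℂ))).comp
    (Homeomorph.mulRight₀ (a / Real.pi) hc).isClosedEmbedding.tendsto_cocompact
  refine h1.congr fun y => ?_
  have h2 : ∀ w, expFactor a (y * Complex.I) w =
      (Real.fourierChar (-(|w|⁻¹ * (y * (a / Real.pi)))) : ℂ) := by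
    intro w
    rw [expFactor_imag, Real.fourierChar_apply]
    congr 1
    have : 2 * Real.pi * -(|w|⁻¹ * (y * (a / Real.pi))) = -(2 * y * a) / |w| := by
      have := Real.pi_ne_zero
      field_simp
    rw [this, mul_comm]
  simp only [h2]
  rw [← integral_timeMeasure hm hm0
    (F := fun x => (Real.fourierChar (-(x * (y * (a / Real.pi)))) : ℂ)) (by fun_prop),
    ← integral_rnDeriv_smul hac]
  refine integral_congr_ae (Eventually.of_forall fun x => ?_)
  simp only [Homeomorph.coe_mulRight₀, Circle.smul_def, smul_eq_mul, Complex.real_smul]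
  rw [mul_comm]

/-- A nonzero absolutely continuous mass charges two separated bands of travel times. -/
theorem ae_eq_zero_of_band_integrals {ν : Measure ℝ} (hν : ν ≪ volume) {m : ℝ → ℝ}
    (hm : Integrable m ν) (hm0 : 0 ≤ᵐ[ν] m)
    (h : ∀ r s t : ℚ, r < s →
      min (∫ w in band 0 r, m w ∂ν) (∫ w in band s t, m w ∂ν) ≤ 0) : m =ᵐ[ν] 0 := by
  have hfin := isFiniteMeasure_timeMeasure hm
  have hac := timeMeasure_absolutelyContinuous hν m
  have hσ : ∀ S, MeasurableSet S → (ν.withDensity fun w => ENNReal.ofReal (m w)) S =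
      ENNReal.ofReal (∫ w in S, m w ∂ν) := by
    intro S hS
    rw [withDensity_apply _ hS, ofReal_integral_eq_lintegral_ofReal hm.integrableOn
      (ae_restrict_of_ae hm0)]
  have hpos : ∀ r s : ℝ, 0 < timeMeasure ν m (Set.Ioo r s) → 0 < ∫ w in band r s, m w ∂ν := by
    intro r s hrs
    rw [timeMeasure, Measure.map_apply (by fun_prop) measurableSet_Ioo] at hrs
    have e : (fun w : ℝ => |w|⁻¹) ⁻¹' Set.Ioo r s = band r s := rfl
    rw [e, hσ _ (measurableSet_band r s)] at hrs
    exact ENNReal.ofReal_pos.1 hrs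
  have hneg : timeMeasure ν m (Set.Iic 0) = 0 := by
    rw [timeMeasure, Measure.map_apply (by fun_prop) measurableSet_Iic]
    refine (withDensity_absolutelyContinuous _ _) (hν ?_)
    refine measure_mono_null (t := {0}) ?_ (by simp)
    intro w hw
    by_contra h0
    have : 0 < |w|⁻¹ := inv_pos.2 (abs_pos.2 h0)
    exact absurd hw (not_le.2 this)
  -- Two distinct support points could be separated by rationals `r < s`, giving two charged bands.
  -- So the support has at most one point, which absolute continuity makes null, and the measure
  -- vanishes.
  have hpair : ∀ x ∈ (timeMeasure ν m).support, ∀ y ∈ (timeMeasure ν m).support, ¬ x < y := by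
    intro x hx y hy hxy
    rw [Measure.mem_support_iff_forall] at hx hy
    obtain ⟨r, hxr, hry⟩ := exists_rat_btwn hxy
    obtain ⟨s, hrs, hsy⟩ := exists_rat_btwn hry
    obtain ⟨t, hyt, -⟩ := exists_rat_btwn (lt_add_one y)
    have h1 : 0 < timeMeasure ν m (Set.Ioo 0 r) := by
      have h2 := hx _ (Iio_mem_nhds hxr)
      have h3 : timeMeasure ν m (Set.Iio (r : ℝ)) ≤
          timeMeasure ν m (Set.Iic 0) + timeMeasure ν m (Set.Ioo 0 r) := by
        refine (measure_mono ?_).trans (measure_union_le _ _)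
        intro z hz
        rcases le_or_gt z 0 with h | h
        · exact Or.inl h
        · exact Or.inr ⟨h, hz⟩
      rw [hneg, zero_add] at h3
      exact h2.trans_le h3
    exact absurd (h r s t (by exact_mod_cast hrs))
      (not_le.2 (lt_min (hpos _ _ h1) (hpos _ _ (hy _ (Ioo_mem_nhds hsy hyt)))))
  have hzero : timeMeasure ν m = 0 := by
    by_contra hne
    obtain ⟨x, hx⟩ := Measure.nonempty_support hne
    have hs : (timeMeasure ν m).support ⊆ {x} := fun y hy => by
      rcases lt_trichotomy x y with h | h | h
      · exact (hpair _ hx _ hy h).elim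
      · exact h.symm
      · exact (hpair _ hy _ hx h).elim
    have h1 : timeMeasure ν m Set.univ = 0 := by
      rw [← Set.union_compl_self ((timeMeasure ν m).support)]
      exact measure_union_null (measure_mono_null hs (hac (by simp)))
        Measure.measure_compl_support
    exact hne (Measure.measure_univ_eq_zero.1 h1)
  have h1 : (ν.withDensity fun w => ENNReal.ofReal (m w)) Set.univ = 0 := by
    have : timeMeasure ν m Set.univ = 0 := by rw [hzero]; simp
    rwa [timeMeasure, Measure.map_apply (by fun_prop) MeasurableSet.univ, Set.preimage_univ] at this
  rw [hσ _ MeasurableSet.univ, setIntegral_univ, ENNReal.ofReal_eq_zero] at h1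
  exact (integral_eq_zero_iff_of_nonneg_ae hm0 hm).1
    (le_antisymm h1 (integral_nonneg_of_ae hm0))

/-! ### The multiplication operators and the reflections. -/

theorem norm_expFactor (a : ℝ) (z : ℂ) (v : ℝ) :
    ‖expFactor a z v‖ = Real.exp (-(2 * z.re * a) / |v|) := by
  rw [expFactor, Complex.norm_exp, Complex.div_ofReal_re]
  congr 2
  simp

theorem norm_expMul_apply_le {a : ℝ} (ha : 0 ≤ a) {z : ℂ} (hz : 0 ≤ z.re) {ν : Measure ℝ}
    (f : Lp ℂ 1 ν) : ‖expMul a z ν f‖ ≤ ‖f‖ := by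
  refine Lp.norm_le_norm_of_ae_le ?_
  filter_upwards [expMul_apply ha hz f] with v hv
  rw [hv, norm_mul]
  exact mul_le_of_le_one_left (norm_nonneg _) (norm_expFactor_le ha hz v)

theorem norm_expMul_le_one {a : ℝ} (ha : 0 ≤ a) {z : ℂ} (hz : 0 ≤ z.re) (ν : Measure ℝ) :
    ‖expMul a z ν‖ ≤ 1 :=
  (expMul a z ν).opNorm_le_bound zero_le_one fun f => by
    rw [one_mul]; exact norm_expMul_apply_le ha hz f

theorem norm_expMul_apply_le_exp {a : ℝ} (ha : 0 ≤ a) {z : ℂ} (hz : 0 ≤ z.re) {ν : Measure ℝ}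
    (hν0 : ∀ᵐ v ∂ν, v ≠ 0) (hν1 : ∀ᵐ v ∂ν, |v| ≤ 1) (f : Lp ℂ 1 ν) :
    ‖expMul a z ν f‖ ≤ Real.exp (-(2 * z.re * a)) * ‖f‖ := by
  refine Lp.norm_le_mul_norm_of_ae_le_mul ?_
  filter_upwards [expMul_apply ha hz f, hν0, hν1] with v hv h0 h1
  rw [hv, norm_mul, norm_expFactor]
  refine mul_le_mul_of_nonneg_right (Real.exp_le_exp.2 ?_) (norm_nonneg _)
  rw [neg_div, neg_le_neg_iff]
  exact le_div_self (by positivity) (abs_pos.2 h0) h1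

theorem expMul_isNonneg {a x : ℝ} (ha : 0 ≤ a) (hx : 0 ≤ x) {ν : Measure ℝ} {f : Lp ℂ 1 ν}
    (hf : IsNonneg f) : IsNonneg (expMul a (x : ℂ) ν f) := by
  filter_upwards [hf, expMul_apply ha (z := (x : ℂ)) (by simpa using hx) f] with v h1 h2
  have e : expFactor a (x : ℂ) v = ((Real.exp (-(2 * x * a) / |v|) : ℝ) : ℂ) := by
    rw [expFactor]
    push_cast
    rfl
  rw [h2, e, Complex.re_ofReal_mul, Complex.im_ofReal_mul, h1.2, mul_zero]
  exact ⟨mul_nonneg (Real.exp_pos _).le h1.1, rfl⟩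

/-- Separates damping, which preserves positivity, from the pure phase, which produces cancellation.
-/
theorem expMul_eq_comp {a : ℝ} (ha : 0 ≤ a) {z : ℂ} (hz : 0 ≤ z.re) {ν : Measure ℝ}
    (f : Lp ℂ 1 ν) :
    expMul a z ν f = expMul a (z.im * Complex.I) ν (expMul a (z.re : ℂ) ν f) := by
  refine Lp.ext ?_
  filter_upwards [expMul_apply ha hz f, expMul_apply ha (z := (z.re : ℂ)) (by simpa using hz) f,
    expMul_apply ha (z := (z.im * Complex.I)) (by simp) (expMul a (z.re : ℂ) ν f)] with v h1 h2 h3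
  rw [h1, h3, h2, ← mul_assoc]
  congr 1
  simp only [expFactor]
  rw [← Complex.exp_add]
  congr 1
  rw [← add_div]
  congr 1
  conv_lhs => rw [← Complex.re_add_im z]
  ring

theorem expMul_expMul {a : ℝ} (ha : 0 ≤ a) {z : ℂ} (hz : 0 ≤ z.re) {ν : Measure ℝ}
    (f : Lp ℂ 1 ν) : expMul a z ν (expMul a z ν f) = expMul (2 * a) z ν f := by
  refine Lp.ext ?_
  filter_upwards [expMul_apply ha hz f, expMul_apply ha hz (expMul a z ν f),
    expMul_apply (by positivity : 0 ≤ 2 * a) hz f] with v h1 h2 h3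
  rw [h2, h1, h3, ← mul_assoc]
  congr 1
  simp only [expFactor]
  rw [← Complex.exp_add]
  congr 1
  push_cast
  ring

/-- Strong continuity in `z` is all that is needed once the densities converge; it follows by
dominated convergence with majorant `2‖f‖`. -/
theorem tendsto_expMul {a : ℝ} (ha : 0 ≤ a) {ν : Measure ℝ} {u : ℕ → ℂ} {z : ℂ}
    (hu : Tendsto u atTop (𝓝 z)) (hu0 : ∀ n, 0 ≤ (u n).re) (hz : 0 ≤ z.re) (f : Lp ℂ 1 ν) :
    Tendsto (fun n => expMul a (u n) ν f) atTop (𝓝 (expMul a z ν f)) := by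
  rw [tendsto_iff_norm_sub_tendsto_zero]
  simp only [L1.norm_eq_integral_norm]
  rw [← integral_zero ℝ ℝ (μ := ν)]
  have hall : ∀ᵐ v ∂ν, ∀ n, (expMul a (u n) ν f - expMul a z ν f : Lp ℂ 1 ν) v =
      (expFactor a (u n) v - expFactor a z v) * f v := by
    refine ae_all_iff.2 fun n => ?_
    filter_upwards [Lp.coeFn_sub (expMul a (u n) ν f) (expMul a z ν f), expMul_apply ha (hu0 n) f,
      expMul_apply ha hz f] with v h1 h2 h3
    rw [h1, Pi.sub_apply, h2, h3, sub_mul]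
  refine tendsto_integral_of_dominated_convergence (fun v => 2 * ‖f v‖)
    (fun n => (Lp.aestronglyMeasurable _).norm) ((L1.integrable_coeFn f).norm.const_mul 2)
    (fun n => ?_) ?_
  · filter_upwards [hall] with v hv
    rw [hv, norm_norm, norm_mul]
    refine mul_le_mul_of_nonneg_right ((norm_sub_le _ _).trans ?_) (norm_nonneg _)
    linarith [norm_expFactor_le ha (hu0 n) v, norm_expFactor_le ha hz v]
  · filter_upwards [hall] with v hv
    simp only [hv]
    have hc : Continuous fun x : ℂ => expFactor a x v := by
      unfold expFactor
      fun_prop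
    have h1 := (((hc.tendsto z).comp hu).sub_const (expFactor a z v)).mul_const (f v)
    rw [sub_self, zero_mul] at h1
    simpa using h1.norm

theorem R₂_expMul {a : ℝ} (ha : 0 ≤ a) {z : ℂ} (hz : 0 ≤ z.re) (f : L1Pos) :
    R₂ (expMul a z μPos f) = expMul a z μNeg (R₂ f) := by
  refine Lp.ext ?_
  filter_upwards [R₂_apply (expMul a z μPos f), R₂_apply f, expMul_apply ha hz (R₂ f),
    measurePreserving_neg_neg.quasiMeasurePreserving.ae (expMul_apply ha hz f)] with v h1 h2 h3 h4
  rw [h1, h4, h3, h2, expFactor, expFactor, abs_neg]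

theorem R₁_expMul {a : ℝ} (ha : 0 ≤ a) {z : ℂ} (hz : 0 ≤ z.re) (f : L1Neg) :
    R₁ (expMul a z μNeg f) = expMul a z μPos (R₁ f) := by
  refine Lp.ext ?_
  filter_upwards [R₁_apply (expMul a z μNeg f), R₁_apply f, expMul_apply ha hz (R₁ f),
    measurePreserving_neg_pos.quasiMeasurePreserving.ae (expMul_apply ha hz f)] with v h1 h2 h3 h4
  rw [h1, h4, h3, h2, expFactor, expFactor, abs_neg]

theorem isStochastic_R₁ : IsStochastic R₁ := by
  refine fun f hf => ⟨?_, (Lp.compMeasurePreservingₗᵢ ℂ _ measurePreserving_neg_pos).norm_map f⟩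
  filter_upwards [R₁_apply f, measurePreserving_neg_pos.quasiMeasurePreserving.ae hf] with v h1 h2
  rw [h1]
  exact h2

theorem isStochastic_R₂ : IsStochastic R₂ := by
  refine fun f hf => ⟨?_, (Lp.compMeasurePreservingₗᵢ ℂ _ measurePreserving_neg_neg).norm_map f⟩
  filter_upwards [R₂_apply f, measurePreserving_neg_neg.quasiMeasurePreserving.ae hf] with v h1 h2
  rw [h1]
  exact h2

theorem IsStochastic.comp {μ ν ρ : Measure ℝ} {A : Lp ℂ 1 ν →L[ℂ] Lp ℂ 1 ρ}
    {B : Lp ℂ 1 μ →L[ℂ] Lp ℂ 1 ν} (hA : IsStochastic A) (hB : IsStochastic B) :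
    IsStochastic (A ∘L B) := fun f hf =>
  ⟨(hA _ (hB f hf).1).1, ((hA _ (hB f hf).1).2).trans (hB f hf).2⟩

/-! ### Overlap of two bands and the loss for a fixed density. -/

/-- Multiplication by the indicator function of a band. -/
noncomputable def bandMul (r s : ℝ) (ν : Measure ℝ) [IsFiniteMeasure ν] :
    Lp ℂ 1 ν →L[ℂ] Lp ℂ 1 ν :=
  (ContinuousLinearMap.mul ℂ ℂ).holderL ν ⊤ 1 1
    (indicatorConstLp ⊤ (measurableSet_band r s) (measure_ne_top _ _) 1)

theorem bandMul_apply (r s : ℝ) {ν : Measure ℝ} [IsFiniteMeasure ν] (f : Lp ℂ 1 ν) :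
    ∀ᵐ v ∂ν, bandMul r s ν f v = (band r s).indicator f v := by
  filter_upwards [(ContinuousLinearMap.mul ℂ ℂ).coeFn_holder (r := 1)
    (indicatorConstLp ⊤ (measurableSet_band r s) (measure_ne_top _ _) 1) f,
    indicatorConstLp_coeFn (p := ⊤) (μ := ν) (hs := measurableSet_band r s)
      (hμs := measure_ne_top _ _) (c := (1 : ℂ))] with v h1 h2
  refine Eq.trans h1 ?_
  rw [h2]
  by_cases hv : v ∈ band r s <;> simp [hv]

/-- The common part of the images under `K` of the two bands `(0, r)` and `(s, t)` of `h ≥ 0`,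
expressed through norms. -/
noncomputable def overlap {ν ρ : Measure ℝ} [IsFiniteMeasure ν] (K : Lp ℂ 1 ν →L[ℂ] Lp ℂ 1 ρ)
    (r s t : ℝ) (h : Lp ℂ 1 ν) : ℝ :=
  (‖K (bandMul 0 r ν h)‖ + ‖K (bandMul s t ν h)‖
    - ‖K (bandMul 0 r ν h) - K (bandMul s t ν h)‖) / 2

/-- The point of writing the overlap through norms: positivity at a limit density persists along the
converging sequence. -/
theorem continuous_overlap {ν ρ : Measure ℝ} [IsFiniteMeasure ν] (K : Lp ℂ 1 ν →L[ℂ] Lp ℂ 1 ρ)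
    (r s t : ℝ) : Continuous (overlap K r s t) := by
  unfold overlap
  fun_prop

section Kernel

variable {ν ρ : Measure ℝ} {k : ℝ → ℝ → ℝ} {K : Lp ℂ 1 ν →L[ℂ] Lp ℂ 1 ρ}

theorem density_spec (hk : IsKernelOf k K) (hk0 : ∀ᵐ v ∂ρ, ∀ᵐ w ∂ν, 0 ≤ k v w) {g : Lp ℂ 1 ν}
    (hg : IsNonneg g) :
    ∀ᵐ v ∂ρ, Integrable (fun w => k v w * (g w).re) ν ∧ 0 ≤ᵐ[ν] (fun w => k v w * (g w).re) ∧
      K g v = ((∫ w, k v w * (g w).re ∂ν : ℝ) : ℂ) := by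
  filter_upwards [hk.2 g, hk0] with v h1 h2
  have e : ∀ᵐ w ∂ν, (k v w : ℂ) * g w = ((k v w * (g w).re : ℝ) : ℂ) := by
    filter_upwards [hg] with w hw
    apply Complex.ext <;> simp [hw.2]
  refine ⟨?_, ?_, ?_⟩
  · simpa using h1.1.re
  · filter_upwards [h2, hg] with w h3 h4
    exact mul_nonneg h3 h4.1
  · rw [h1.2, integral_congr_ae e, integral_complex_ofReal]

theorem apply_expMul (hk : IsKernelOf k K) {g : Lp ℂ 1 ν} (hg : IsNonneg g) {a : ℝ} (ha : 0 ≤ a)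
    (y : ℝ) : ∀ᵐ v ∂ρ, K (expMul a (y * Complex.I) ν g) v =
      ∫ w, ((k v w * (g w).re : ℝ) : ℂ) * expFactor a (y * Complex.I) w ∂ν := by
  filter_upwards [hk.2 (expMul a (y * Complex.I) ν g)] with v h1
  rw [h1.2]
  refine integral_congr_ae ?_
  filter_upwards [hg, expMul_apply ha (z := y * Complex.I) (by simp) g] with w hw h2
  have : g w = ((g w).re : ℂ) := Complex.ext (by simp) (by simp [hw.2])
  rw [h2, this]
  push_cast
  simp only [Complex.ofReal_re]
  ring

theorem apply_bandMul [IsFiniteMeasure ν] (hk : IsKernelOf k K) {g : Lp ℂ 1 ν} (hg : IsNonneg g)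
    (r s : ℝ) : ∀ᵐ v ∂ρ, K (bandMul r s ν g) v =
      ((∫ w in band r s, k v w * (g w).re ∂ν : ℝ) : ℂ) := by
  filter_upwards [hk.2 (bandMul r s ν g)] with v h1
  rw [h1.2, ← integral_indicator (measurableSet_band r s), ← integral_complex_ofReal]
  refine integral_congr_ae ?_
  filter_upwards [hg, bandMul_apply r s g] with w hw h2
  rw [h2]
  by_cases hv : w ∈ band r s
  · simp only [hv, Set.indicator_of_mem]
    apply Complex.ext <;> simp [hw.2]
  · simp [hv]

/-- Integrate `min x y = (x + y - |x - y|) / 2` over `v`, using that both band images are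
nonnegative. -/
theorem overlap_eq_integral [IsFiniteMeasure ν] (hk : IsKernelOf k K)
    (hk0 : ∀ᵐ v ∂ρ, ∀ᵐ w ∂ν, 0 ≤ k v w) {g : Lp ℂ 1 ν} (hg : IsNonneg g) (r s t : ℝ) :
    Integrable (fun v => min (∫ w in band 0 r, k v w * (g w).re ∂ν)
      (∫ w in band s t, k v w * (g w).re ∂ν)) ρ ∧
    overlap K r s t g = ∫ v, min (∫ w in band 0 r, k v w * (g w).re ∂ν)
      (∫ w in band s t, k v w * (g w).re ∂ν) ∂ρ := by
  set f₁ := K (bandMul 0 r ν g) with hf₁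
  set f₂ := K (bandMul s t ν g) with hf₂
  have e : ∀ᵐ v ∂ρ, (‖f₁ v‖ + ‖f₂ v‖ - ‖(f₁ - f₂ : Lp ℂ 1 ρ) v‖) / 2 =
      min (∫ w in band 0 r, k v w * (g w).re ∂ν) (∫ w in band s t, k v w * (g w).re ∂ν) := by
    filter_upwards [apply_bandMul hk hg 0 r, apply_bandMul hk hg s t, density_spec hk hk0 hg,
      Lp.coeFn_sub f₁ f₂] with v h1 h2 h3 h4
    have p1 : 0 ≤ ∫ w in band 0 r, k v w * (g w).re ∂ν :=
      integral_nonneg_of_ae (ae_restrict_of_ae h3.2.1)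
    have p2 : 0 ≤ ∫ w in band s t, k v w * (g w).re ∂ν :=
      integral_nonneg_of_ae (ae_restrict_of_ae h3.2.1)
    rw [h4, Pi.sub_apply, h1, h2, ← Complex.ofReal_sub, Complex.norm_real, Complex.norm_real,
      Complex.norm_real, Real.norm_of_nonneg p1, Real.norm_of_nonneg p2, Real.norm_eq_abs]
    rcases le_total (∫ w in band 0 r, k v w * (g w).re ∂ν) (∫ w in band s t, k v w * (g w).re ∂ν)
      with h | h
    · rw [min_eq_left h, abs_of_nonpos (sub_nonpos.2 h)]
      ring
    · rw [min_eq_right h, abs_of_nonneg (sub_nonneg.2 h)]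
      ring
  have i1 := (L1.integrable_coeFn f₁).norm
  have i2 := (L1.integrable_coeFn f₂).norm
  have i3 := (L1.integrable_coeFn (f₁ - f₂)).norm
  refine ⟨(((i1.add i2).sub i3).div_const 2).congr e, ?_⟩
  rw [← integral_congr_ae e, integral_div,
    integral_sub (f := fun v => ‖f₁ v‖ + ‖f₂ v‖) (i1.add i2) i3, integral_add i1 i2,
    ← L1.norm_eq_integral_norm, ← L1.norm_eq_integral_norm, ← L1.norm_eq_integral_norm, overlap]

/-- Equality of norms would force equality in the triangle inequality for almost every `v`, hence
`k(v,·) g = 0` and `K g = 0`, contradicting norm preservation. -/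
theorem norm_apply_expMul_lt (hν : ν ≪ volume) (hk : IsKernelOf k K) (hK : IsStochastic K)
    (hk0 : ∀ᵐ v ∂ρ, ∀ᵐ w ∂ν, 0 ≤ k v w) {g : Lp ℂ 1 ν} (hg : IsNonneg g) (hg1 : g ≠ 0)
    {a y : ℝ} (ha : 0 < a) (hy : y ≠ 0) : ‖K (expMul a (y * Complex.I) ν g)‖ < ‖g‖ := by
  by_contra hcon
  have hcon := not_lt.1 hcon
  have i1 := (L1.integrable_coeFn (K g)).norm
  have i2 := (L1.integrable_coeFn (K (expMul a (y * Complex.I) ν g))).norm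
  have hle : ∀ᵐ v ∂ρ, 0 ≤ ‖K g v‖ - ‖K (expMul a (y * Complex.I) ν g) v‖ := by
    filter_upwards [density_spec hk hk0 hg, apply_expMul hk hg ha.le y] with v h1 h2
    have p1 := integral_nonneg_of_ae h1.2.1
    rw [h1.2.2, h2, Complex.norm_real, Real.norm_of_nonneg p1, sub_nonneg]
    refine (norm_integral_le_integral_norm _).trans (le_of_eq (integral_congr_ae ?_))
    filter_upwards [h1.2.1] with w hw
    rw [norm_mul, norm_expFactor_imag, mul_one, Complex.norm_real, Real.norm_of_nonneg hw]
  have h0 : ∫ v, (‖K g v‖ - ‖K (expMul a (y * Complex.I) ν g) v‖) ∂ρ = 0 := by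
    refine le_antisymm ?_ (integral_nonneg_of_ae hle)
    rw [integral_sub i1 i2, ← L1.norm_eq_integral_norm, ← L1.norm_eq_integral_norm, (hK g hg).2]
    linarith
  rw [integral_eq_zero_iff_of_nonneg_ae hle (i1.sub i2)] at h0
  have hz : K g = 0 := by
    rw [Lp.eq_zero_iff_ae_eq_zero]
    filter_upwards [density_spec hk hk0 hg, apply_expMul hk hg ha.le y, h0] with v h1 h2 h3
    have p1 := integral_nonneg_of_ae h1.2.1
    have h4 := sub_eq_zero.1 h3
    rw [h1.2.2, h2, Complex.norm_real, Real.norm_of_nonneg p1] at h4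
    have h5 := ae_eq_zero_of_norm_integral_eq h1.1 h1.2.1
      (measurable_expFactor a (y * Complex.I)).aestronglyMeasurable (norm_expFactor_imag a y)
      (fun u => hν ((countable_expFactor_eq ha.ne' hy u).ae_notMem volume)) h4.le
    rw [h1.2.2, integral_congr_ae h5]
    simp
  have := (hK g hg).2
  rw [hz, norm_zero] at this
  exact hg1 (norm_eq_zero.1 this.symm)

/-- Riemann-Lebesgue for almost every fixed `v`, then dominated convergence with majorant `|K g|`.
-/
theorem tendsto_apply_expMul_zero (hν : ν ≪ volume) (hk : IsKernelOf k K)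
    (hk0 : ∀ᵐ v ∂ρ, ∀ᵐ w ∂ν, 0 ≤ k v w) {g : Lp ℂ 1 ν} (hg : IsNonneg g)
    {a : ℝ} (ha : 0 < a) {y : ℕ → ℝ} (hy : Tendsto y atTop (cocompact ℝ)) :
    Tendsto (fun n => ‖K (expMul a (y n * Complex.I) ν g)‖) atTop (𝓝 0) := by
  simp only [L1.norm_eq_integral_norm]
  rw [← integral_zero ℝ ℝ (μ := ρ)]
  have hall := ae_all_iff.2 fun n => apply_expMul hk hg ha.le (y n)
  refine tendsto_integral_of_dominated_convergence (fun v => ‖K g v‖)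
    (fun n => (Lp.aestronglyMeasurable _).norm) (L1.integrable_coeFn (K g)).norm
    (fun n => ?_) ?_
  · filter_upwards [density_spec hk hk0 hg, hall] with v h1 h2
    have p1 := integral_nonneg_of_ae h1.2.1
    rw [h1.2.2, h2, Complex.norm_real, Real.norm_of_nonneg p1, norm_norm]
    refine (norm_integral_le_integral_norm _).trans (le_of_eq (integral_congr_ae ?_))
    filter_upwards [h1.2.1] with w hw
    rw [norm_mul, norm_expFactor_imag, mul_one, Complex.norm_real, Real.norm_of_nonneg hw]
  · filter_upwards [density_spec hk hk0 hg, hall] with v h1 h2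
    simp only [h2]
    simpa using ((tendsto_integral_expFactor hν h1.1 h1.2.1 ha.ne').comp hy).norm

/-- The two-band loss integrated over `v`. The phase separation is linear in `|y|`, so the loss is
quadratic. -/
theorem norm_apply_expMul_le_sub [IsFiniteMeasure ν] (hk : IsKernelOf k K)
    (hK : IsStochastic K) (hk0 : ∀ᵐ v ∂ρ, ∀ᵐ w ∂ν, 0 ≤ k v w) {g : Lp ℂ 1 ν} (hg : IsNonneg g)
    {a y r s t : ℝ} (ha : 0 < a) (hrs : r < s) (hy : 2 * a * t * |y| ≤ Real.pi) :
    ‖K (expMul a (y * Complex.I) ν g)‖ ≤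
      ‖g‖ - (4 / Real.pi * a * (s - r) * |y|) ^ 2 / 8 * overlap K r s t g := by
  obtain ⟨hi, ho⟩ := overlap_eq_integral hk hk0 hg r s t
  have i1 := (L1.integrable_coeFn (K g)).norm
  rw [ho, ← integral_const_mul, ← (hK g hg).2, L1.norm_eq_integral_norm, L1.norm_eq_integral_norm,
    ← integral_sub i1 (hi.const_mul _)]
  refine integral_mono_ae (L1.integrable_coeFn _).norm (i1.sub (hi.const_mul _)) ?_
  filter_upwards [density_spec hk hk0 hg, apply_expMul hk hg ha.le y] with v h1 h2
  have p1 := integral_nonneg_of_ae h1.2.1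
  simp only [h1.2.2, h2, Complex.norm_real, Real.norm_of_nonneg p1]
  exact norm_integral_le_sub_min h1.1 h1.2.1
    (measurable_expFactor a (y * Complex.I)).aestronglyMeasurable (norm_expFactor_imag a y)
    (measurableSet_band 0 r) (measurableSet_band s t)
    (mul_nonneg (mul_nonneg (by positivity) (by linarith)) (abs_nonneg y))
    (fun w hw w' hw' => expFactor_sep ha hrs hy hw hw')

/-- If all overlaps vanished, then for almost every `v` the density `k(v,·) g` would charge no two
separated bands and be zero, so `K g = 0`. Rational endpoints keep the exceptional set null. -/
theorem exists_overlap_pos [IsFiniteMeasure ν] (hν : ν ≪ volume) (hk : IsKernelOf k K)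
    (hK : IsStochastic K) (hk0 : ∀ᵐ v ∂ρ, ∀ᵐ w ∂ν, 0 ≤ k v w) {g : Lp ℂ 1 ν} (hg : IsNonneg g)
    (hg1 : g ≠ 0) : ∃ r s t : ℚ, r < s ∧ 0 < overlap K r s t g := by
  by_contra! hcon
  have hall : ∀ᵐ v ∂ρ, ∀ r s t : ℚ, r < s → min (∫ w in band 0 r, k v w * (g w).re ∂ν)
      (∫ w in band s t, k v w * (g w).re ∂ν) ≤ 0 := by
    refine ae_all_iff.2 fun r => ae_all_iff.2 fun s => ae_all_iff.2 fun t => ?_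
    by_cases hrs : r < s
    swap
    · exact Eventually.of_forall fun v h => absurd h hrs
    obtain ⟨hi, ho⟩ := overlap_eq_integral hk hk0 hg r s t
    have hnn : ∀ᵐ v ∂ρ, 0 ≤ min (∫ w in band 0 r, k v w * (g w).re ∂ν)
        (∫ w in band s t, k v w * (g w).re ∂ν) := by
      filter_upwards [density_spec hk hk0 hg] with v h1
      exact le_min (integral_nonneg_of_ae (ae_restrict_of_ae h1.2.1))
        (integral_nonneg_of_ae (ae_restrict_of_ae h1.2.1))
    have h0 := le_antisymm (ho ▸ hcon r s t hrs) (integral_nonneg_of_ae hnn)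
    rw [integral_eq_zero_iff_of_nonneg_ae hnn hi] at h0
    filter_upwards [h0] with v hv _
    exact hv.le
  have hz : K g = 0 := by
    rw [Lp.eq_zero_iff_ae_eq_zero]
    filter_upwards [density_spec hk hk0 hg, hall] with v h1 h2
    rw [h1.2.2, integral_congr_ae (ae_eq_zero_of_band_integrals hν h1.1 h1.2.1 h2)]
    simp
  have := (hK g hg).2
  rw [hz, norm_zero] at this
  exact hg1 (norm_eq_zero.1 this.symm)

end Kernel

/-! ### Uniform estimates by compactness. -/

section Compactness

variable {μ ν ρ : Measure ℝ} {K : Lp ℂ 1 ν →L[ℂ] Lp ℂ 1 ρ} {H : Lp ℂ 1 μ →L[ℂ] Lp ℂ 1 ν}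

theorem expMul_zero {a : ℝ} (ha : 0 ≤ a) (f : Lp ℂ 1 ν) : expMul a 0 ν f = f := by
  refine Lp.ext ?_
  filter_upwards [expMul_apply ha (z := 0) (by simp) f] with v hv
  rw [hv, expFactor]
  simp

/-- Almost maximizing densities for `K e^{-2za/|v|} H` subconverge. -/
theorem exists_subseq_maximizing (hH : IsStochastic H)
    (hHc : IsCompactOperator H) {a : ℝ} (ha : 0 ≤ a) {z : ℕ → ℂ} (hz : ∀ n, 0 ≤ (z n).re)
    (hz0 : Tendsto (fun n => (z n).re) atTop (𝓝 0)) {ε : ℕ → ℝ} (hε : ∀ n, ε n ≤ 1)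
    (h : ∀ n, 1 - ε n < ‖K ∘L expMul a (z n) ν ∘L H‖) :
    ∃ (φ : ℕ → ℕ) (g' : ℕ → Lp ℂ 1 ν) (g : Lp ℂ 1 ν), StrictMono φ ∧ (∀ n, IsNonneg (g' n)) ∧
      (∀ n, ‖g' n‖ ≤ 1) ∧ Tendsto g' atTop (𝓝 g) ∧ IsNonneg g ∧ ‖g‖ = 1 ∧
      ∀ n, 1 - ε (φ n) < ‖K (expMul a ((z (φ n)).im * Complex.I) ν (g' n))‖ := by
  have hf : ∀ n, ∃ f : Lp ℂ 1 μ, IsNonneg f ∧ ‖f‖ = 1 ∧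
      1 - ε n < ‖K (expMul a (z n) ν (H f))‖ := by
    intro n
    by_contra! hcon
    exact absurd (opNorm_le_of_nonneg (K ∘L expMul a (z n) ν ∘L H) (sub_nonneg.2 (hε n)) hcon)
      (not_le.2 (h n))
  choose f hf0 hf1 hf2 using hf
  have hcomp : IsCompact (closure (H '' Metric.closedBall 0 1)) :=
    hHc.isCompact_closure_image_closedBall 1
  obtain ⟨g, -, φ, hφ, hg⟩ := hcomp.tendsto_subseq (x := fun n => H (f n)) fun n =>
    subset_closure ⟨f n, by simp [hf1], rfl⟩
  have hgn : IsNonneg g := isClosed_isNonneg.mem_of_tendsto hg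
    (Eventually.of_forall fun n => (hH _ (hf0 _)).1)
  have hg1 : ‖g‖ = 1 := by
    refine tendsto_nhds_unique hg.norm ?_
    simp [(hH _ (hf0 _)).2, hf1]
  have hx : ∀ n, 0 ≤ (((z (φ n)).re : ℝ) : ℂ).re := fun n => by simpa using hz (φ n)
  -- The damping goes into the densities, leaving a pure phase; they still converge to `g` because
  -- `Re z → 0` and damping is a contraction.
  refine ⟨φ, fun n => expMul a ((z (φ n)).re : ℂ) ν (H (f (φ n))), g, hφ,
    fun n => expMul_isNonneg ha (hz _) (hH _ (hf0 _)).1, fun n => ?_, ?_, hgn, hg1, fun n => ?_⟩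
  · refine (norm_expMul_apply_le ha (hx n) _).trans ?_
    rw [(hH _ (hf0 _)).2, hf1]
  · have t1 : Tendsto (fun n => expMul a ((z (φ n)).re : ℂ) ν g) atTop (𝓝 g) := by
      have := tendsto_expMul (ν := ν) ha (u := fun n => (((z (φ n)).re : ℝ) : ℂ)) (z := 0)
        (by simpa [Function.comp_def] using
          (Complex.continuous_ofReal.tendsto 0).comp (hz0.comp hφ.tendsto_atTop))
        hx (by simp) g
      rwa [expMul_zero ha] at this
    have t2 : Tendsto (fun n => expMul a ((z (φ n)).re : ℂ) ν (H (f (φ n)) - g)) atTop (𝓝 0) := by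
      refine squeeze_zero_norm (fun n => norm_expMul_apply_le ha (hx n) _) ?_
      exact tendsto_iff_norm_sub_tendsto_zero.1 hg
    have := t2.add t1
    rw [zero_add] at this
    refine this.congr fun n => ?_
    rw [← map_add, sub_add_cancel]
  · rw [← expMul_eq_comp ha (hz _)]
    exact hf2 _

theorem norm_comp_expMul_comp_le_exp {a : ℝ} (ha : 0 ≤ a) (hν : ν ≪ volume)
    (hν1 : ∀ᵐ v ∂ν, |v| ≤ 1) (hK : IsStochastic K) (hH : IsStochastic H) {z : ℂ}
    (hz : 0 ≤ z.re) : ‖K ∘L expMul a z ν ∘L H‖ ≤ Real.exp (-(2 * z.re * a)) := by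
  refine opNorm_le_of_nonneg _ (Real.exp_pos _).le fun f hf hf1 => ?_
  refine (K.le_of_opNorm_le hK.norm_le_one _).trans ?_
  rw [one_mul]
  refine (norm_expMul_apply_le_exp ha hz (hν ((Set.countable_singleton 0).ae_notMem volume))
    hν1 (H f)).trans ?_
  rw [(hH f hf).2, hf1, mul_one]

/-- Otherwise norms tend to `1` along some sequence of `z`. Damping forces `Re z → 0`, and a limit
density `g` of norm one suffers asymptotically no loss; neither bounded nor unbounded `Im z` allows
this. -/
theorem exists_norm_comp_expMul_comp_le {a : ℝ} (ha : 0 < a) (hν : ν ≪ volume)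
    (hν1 : ∀ᵐ v ∂ν, |v| ≤ 1) {k : ℝ → ℝ → ℝ} (hk : IsKernelOf k K)
    (hk0 : ∀ᵐ v ∂ρ, ∀ᵐ w ∂ν, 0 ≤ k v w) (hK : IsStochastic K) (hH : IsStochastic H)
    (hHc : IsCompactOperator H) {η : ℝ} (hη : 0 < η) :
    ∃ c < 1, ∀ z : ℂ, 0 ≤ z.re → η ≤ ‖z‖ → ‖K ∘L expMul a z ν ∘L H‖ ≤ c := by
  by_contra! hcon
  have h1 : ∀ n : ℕ, (1 : ℝ) - 1 / (n + 1) < 1 := fun n => sub_lt_self _ (by positivity)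
  choose z hz hzη hzn using fun n : ℕ => hcon _ (h1 n)
  have hε : Tendsto (fun n : ℕ => (1 : ℝ) - 1 / (n + 1)) atTop (𝓝 1) := by
    simpa using tendsto_one_div_add_atTop_nhds_zero_nat.const_sub (1 : ℝ)
  have hz0 : Tendsto (fun n => (z n).re) atTop (𝓝 0) := by
    have he : Tendsto (fun n => Real.exp (-(2 * (z n).re * a))) atTop (𝓝 1) := by
      refine tendsto_of_tendsto_of_tendsto_of_le_of_le hε tendsto_const_nhds
        (fun n => (hzn n).le.trans (norm_comp_expMul_comp_le_exp ha.le hν hν1 hK hH (hz n)))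
        fun n => Real.exp_le_one_iff.2 ?_
      have := mul_nonneg (hz n) ha.le
      linarith
    have hl := ((Real.continuousAt_log one_ne_zero).tendsto.comp he).div_const (-(2 * a))
    simp only [Function.comp_def, Real.log_exp, Real.log_one, zero_div] at hl
    refine hl.congr fun n => ?_
    field_simp
  obtain ⟨φ, g', g, hφ, hg'0, hg'1, hg', hg0, hg1, hlt⟩ := exists_subseq_maximizing hH hHc
    ha.le hz hz0 (fun n => by rw [div_le_one (by positivity)]; linarith [n.cast_nonneg (α := ℝ)]) hzn
  have hne : g ≠ 0 := fun h => by simp [h] at hg1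
  have hlim : Tendsto (fun n => ‖K (expMul a ((z (φ n)).im * Complex.I) ν g)‖) atTop (𝓝 1) := by
    have hd : Tendsto (fun n => ‖g' n - g‖) atTop (𝓝 0) := tendsto_iff_norm_sub_tendsto_zero.1 hg'
    have hlow := (hε.comp hφ.tendsto_atTop).sub hd
    rw [sub_zero] at hlow
    refine tendsto_of_tendsto_of_tendsto_of_le_of_le hlow tendsto_const_nhds (fun n => ?_)
      fun n => ?_
    · have e : K (expMul a ((z (φ n)).im * Complex.I) ν (g' n)) =
          K (expMul a ((z (φ n)).im * Complex.I) ν g) +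
          K (expMul a ((z (φ n)).im * Complex.I) ν (g' n - g)) := by
        rw [← map_add, ← map_add, add_sub_cancel]
      have h2 := hlt n
      rw [e] at h2
      have h3 : ‖K (expMul a ((z (φ n)).im * Complex.I) ν (g' n - g))‖ ≤ ‖g' n - g‖ := by
        refine (K.le_of_opNorm_le hK.norm_le_one _).trans ?_
        rw [one_mul]
        exact norm_expMul_apply_le ha.le (by simp) _
      have h4 := norm_add_le (K (expMul a ((z (φ n)).im * Complex.I) ν g))
        (K (expMul a ((z (φ n)).im * Complex.I) ν (g' n - g)))
      simp only [Function.comp_apply]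
      linarith
    · refine (K.le_of_opNorm_le hK.norm_le_one _).trans ?_
      rw [one_mul, ← hg1]
      exact norm_expMul_apply_le ha.le (by simp) _
  -- Either a subsequence of `Im z` has a limit `y`, nonzero because `η ≤ ‖z‖` and `Re z → 0`,
  -- contradicting strict loss; or `|Im z| → ∞`, contradicting Riemann-Lebesgue.
  by_cases hb : ∃ M : ℝ, ∃ᶠ n in atTop, (z (φ n)).im ∈ Metric.closedBall (0 : ℝ) M
  · obtain ⟨M, hM⟩ := hb
    obtain ⟨y, -, ψ, hψ, hy⟩ := (isCompact_closedBall (0 : ℝ) M).tendsto_subseq' hM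
    have hy0 : y ≠ 0 := by
      rintro rfl
      have hzt : Tendsto (fun n => z (φ (ψ n))) atTop (𝓝 0) := by
        have t1 := (Complex.continuous_ofReal.tendsto 0).comp
          (hz0.comp (hφ.tendsto_atTop.comp hψ.tendsto_atTop))
        have t2 := (((Complex.continuous_ofReal.tendsto 0).comp hy).mul_const Complex.I)
        simpa [Function.comp_def, Complex.re_add_im] using t1.add t2
      have := ge_of_tendsto' hzt.norm fun n => hzη (φ (ψ n))
      rw [norm_zero] at this
      linarith
    have t1 : Tendsto (fun n => ‖K (expMul a ((z (φ (ψ n))).im * Complex.I) ν g)‖) atTop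
        (𝓝 ‖K (expMul a (y * Complex.I) ν g)‖) := by
      refine ((K.continuous.tendsto _).comp (tendsto_expMul ha.le ?_ ?_ ?_ g)).norm
      · exact ((Complex.continuous_ofReal.tendsto y).comp hy).mul_const Complex.I
      · simp
      · simp
    have t2 := tendsto_nhds_unique t1 (hlim.comp hψ.tendsto_atTop)
    have t3 := norm_apply_expMul_lt hν hk hK hk0 hg0 hne ha hy0
    rw [t2, hg1] at t3
    exact lt_irrefl _ t3
  · push Not at hb
    have hcc : Tendsto (fun n => (z (φ n)).im) atTop (cocompact ℝ) := by
      rw [← Metric.cobounded_eq_cocompact, ← tendsto_norm_atTop_iff_cobounded, tendsto_atTop]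
      intro M
      filter_upwards [hb M] with n hn
      rw [mem_closedBall_zero_iff, not_le] at hn
      exact hn.le
    exact zero_ne_one (tendsto_nhds_unique (tendsto_apply_expMul_zero hν hk hk0 hg0 ha hcc) hlim)

/-- A pair of bands with positive overlap for the limit density serves all late densities too. They
lose at least `C |Im z|²`, while failure of the claim allows less than `|Im z|² / (n + 1)`. -/
theorem exists_norm_comp_expMul_comp_le_quadratic [IsFiniteMeasure ν] {a : ℝ} (ha : 0 < a)
    (hν : ν ≪ volume) {k : ℝ → ℝ → ℝ} (hk : IsKernelOf k K)
    (hk0 : ∀ᵐ v ∂ρ, ∀ᵐ w ∂ν, 0 ≤ k v w) (hK : IsStochastic K) (hH : IsStochastic H)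
    (hHc : IsCompactOperator H) :
    ∃ c : ℝ, 0 < c ∧ ∀ᶠ z in 𝓝[{z : ℂ | 0 ≤ z.re}] 0,
      ‖K ∘L expMul a z ν ∘L H‖ ≤ 1 - c * |z.im| ^ 2 := by
  by_contra! hcon
  have hex : ∀ n : ℕ, ∃ z : ℂ, 0 ≤ z.re ∧ ‖z‖ < 1 / ((n : ℝ) + 1) ∧
      1 - 1 / ((n : ℝ) + 1) * |z.im| ^ 2 < ‖K ∘L expMul a z ν ∘L H‖ := by
    intro n
    have hpos : (0 : ℝ) < 1 / ((n : ℝ) + 1) := by positivity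
    have h2 : ∀ᶠ z : ℂ in 𝓝[{z : ℂ | 0 ≤ z.re}] 0, ‖z‖ < 1 / ((n : ℝ) + 1) :=
      nhdsWithin_le_nhds
        ((continuous_norm.tendsto' (0 : ℂ) 0 norm_zero).eventually (gt_mem_nhds hpos))
    obtain ⟨z, hz1, hz2, hz3⟩ :=
      ((hcon _ hpos).and_eventually (h2.and self_mem_nhdsWithin)).exists
    exact ⟨z, hz3, hz2, hz1⟩
  choose z hz hzn hlt0 using hex
  have hinv : Tendsto (fun n : ℕ => 1 / ((n : ℝ) + 1)) atTop (𝓝 0) :=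
    tendsto_one_div_add_atTop_nhds_zero_nat
  have hzt : Tendsto z atTop (𝓝 0) := squeeze_zero_norm (fun n => (hzn n).le) hinv
  have hz0 : Tendsto (fun n => (z n).re) atTop (𝓝 0) := by
    simpa [Function.comp_def] using (Complex.continuous_re.tendsto 0).comp hzt
  have hz0' : Tendsto (fun n => |(z n).im|) atTop (𝓝 0) := by
    simpa [Function.comp_def] using ((Complex.continuous_im.tendsto 0).comp hzt).abs
  have hle1 : ∀ n : ℕ, 1 / ((n : ℝ) + 1) ≤ 1 := fun n => by
    rw [div_le_one (by positivity)]
    linarith [n.cast_nonneg (α := ℝ)]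
  obtain ⟨φ, g', g, hφ, hg'0, hg'1, hg', hg0, hg1, hlt⟩ := exists_subseq_maximizing hH hHc
    ha.le hz hz0 (fun n => mul_le_one₀ (hle1 n) (by positivity) (pow_le_one₀ (abs_nonneg _)
      ((Complex.abs_im_le_norm _).trans ((hzn n).le.trans (hle1 n))))) hlt0
  have hne : g ≠ 0 := fun h => by simp [h] at hg1
  obtain ⟨r, s, t, hrs, hpos⟩ := exists_overlap_pos hν hk hK hk0 hg0 hne
  have hrs' : (r : ℝ) < s := by exact_mod_cast hrs
  set q := overlap K r s t g
  -- Half of the limiting overlap `q` leaves room for the densities `g' n`.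
  set C := (4 / Real.pi * a * (s - r)) ^ 2 / 8 * (q / 2) with hC
  have hCpos : 0 < C := by
    have := sub_pos.2 hrs'
    have := Real.pi_pos
    positivity
  have e1 : ∀ᶠ n in atTop, q / 2 < overlap K r s t (g' n) :=
    (((continuous_overlap K r s t).tendsto g).comp hg').eventually (lt_mem_nhds (half_lt_self hpos))
  have e2 : ∀ᶠ n in atTop, 2 * a * t * |(z (φ n)).im| < Real.pi := by
    have := (hz0'.comp hφ.tendsto_atTop).const_mul (2 * a * t)
    rw [mul_zero] at this
    exact this.eventually (gt_mem_nhds Real.pi_pos)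
  have e3 : ∀ᶠ n in atTop, 1 / ((φ n : ℝ) + 1) < C :=
    (hinv.comp hφ.tendsto_atTop).eventually (gt_mem_nhds hCpos)
  obtain ⟨n, h1, h2, h3⟩ := (e1.and (e2.and e3)).exists
  have h4 := norm_apply_expMul_le_sub hk hK hk0 (hg'0 n) ha hrs' h2.le
  have h5 := hlt n
  have h6 := hg'1 n
  have h7 : C * |(z (φ n)).im| ^ 2 ≤
      (4 / Real.pi * a * (s - r) * |(z (φ n)).im|) ^ 2 / 8 * overlap K r s t (g' n) := by
    rw [hC, mul_pow _ |(z (φ n)).im|]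
    calc _ = (4 / Real.pi * a * (s - r)) ^ 2 * |(z (φ n)).im| ^ 2 / 8 * (q / 2) := by ring
      _ ≤ _ := mul_le_mul_of_nonneg_left h1.le (by positivity)
  have h8 : 1 / ((φ n : ℝ) + 1) * |(z (φ n)).im| ^ 2 ≤ C * |(z (φ n)).im| ^ 2 :=
    mul_le_mul_of_nonneg_right h3.le (by positivity)
  linarith

end Compactness

theorem absolutelyContinuous_restrict_volume (s : Set ℝ) :
    volume.restrict s ≪ (volume : Measure ℝ) :=
  Measure.absolutelyContinuous_of_le Measure.restrict_le_self

theorem ae_abs_le_one_pos : ∀ᵐ v ∂μPos, |v| ≤ 1 := by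
  filter_upwards [ae_restrict_mem measurableSet_Ioo] with v hv
  exact abs_le.2 ⟨by linarith [hv.1], hv.2.le⟩

theorem ae_abs_le_one_neg : ∀ᵐ v ∂μNeg, |v| ≤ 1 := by
  filter_upwards [ae_restrict_mem measurableSet_Ioo] with v hv
  exact abs_le.2 ⟨hv.1.le, by linarith [hv.2]⟩

/-! ### From one contracting term to `G` and its resolvent. -/

section Mixture

variable {E₁ E₂ E₃ E₄ : Type*} [NormedAddCommGroup E₁] [NormedSpace ℂ E₁]
  [NormedAddCommGroup E₂] [NormedSpace ℂ E₂] [NormedAddCommGroup E₃] [NormedSpace ℂ E₃]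
  [NormedAddCommGroup E₄] [NormedSpace ℂ E₄]

theorem norm_comp_le_one {P : E₂ →L[ℂ] E₃} {Q : E₁ →L[ℂ] E₂} (hP : ‖P‖ ≤ 1) (hQ : ‖Q‖ ≤ 1) :
    ‖P ∘L Q‖ ≤ 1 :=
  (P.opNorm_comp_le Q).trans (mul_le_one₀ hP (norm_nonneg _) hQ)

theorem norm_mixture_le_one {P K : E₁ →L[ℂ] E₂} {α β : ℝ} (hα : 0 ≤ α) (hβ : 0 ≤ β)
    (h : α + β = 1) (hP : ‖P‖ ≤ 1) (hK : ‖K‖ ≤ 1) : ‖(α : ℂ) • P + (β : ℂ) • K‖ ≤ 1 := by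
  refine (norm_add_le _ _).trans ?_
  rw [norm_smul, norm_smul, Complex.norm_real, Complex.norm_real, Real.norm_of_nonneg hα,
    Real.norm_of_nonneg hβ, ← h]
  exact add_le_add (mul_le_of_le_one_right hα hP) (mul_le_of_le_one_right hβ hK)

/-- The weights `α`, `β α'`, `β β'` sum to one, and only the last term has a bound `q` instead of
`1`. -/
theorem norm_mixture_comp_mixture_le {P K : E₃ →L[ℂ] E₄} {X : E₂ →L[ℂ] E₃} {P' K' : E₁ →L[ℂ] E₂}
    {α β α' β' q : ℝ} (hα : 0 ≤ α) (hβ : 0 ≤ β) (hα' : 0 ≤ α') (hβ' : 0 ≤ β') (h : α + β = 1)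
    (h' : α' + β' = 1) (hP : ‖P‖ ≤ 1) (hK : ‖K‖ ≤ 1) (hX : ‖X‖ ≤ 1) (hP' : ‖P'‖ ≤ 1)
    (hK' : ‖K'‖ ≤ 1) (hq : ‖K ∘L X ∘L K'‖ ≤ q) :
    ‖((α : ℂ) • P + (β : ℂ) • K) ∘L X ∘L ((α' : ℂ) • P' + (β' : ℂ) • K')‖ ≤
      1 - β * β' * (1 - q) := by
  have e : ((α : ℂ) • P + (β : ℂ) • K) ∘L X ∘L ((α' : ℂ) • P' + (β' : ℂ) • K') =
      (α : ℂ) • (P ∘L X ∘L ((α' : ℂ) • P' + (β' : ℂ) • K')) +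
      ((β : ℂ) • (α' : ℂ) • (K ∘L X ∘L P') + (β : ℂ) • (β' : ℂ) • (K ∘L X ∘L K')) := by
    simp only [ContinuousLinearMap.add_comp, ContinuousLinearMap.comp_add,
      ContinuousLinearMap.smul_comp, ContinuousLinearMap.comp_smul, smul_add]
    module
  have n1 : ‖P ∘L X ∘L ((α' : ℂ) • P' + (β' : ℂ) • K')‖ ≤ 1 :=
    norm_comp_le_one hP (norm_comp_le_one hX (norm_mixture_le_one hα' hβ' h' hP' hK'))
  have n2 : ‖K ∘L X ∘L P'‖ ≤ 1 := norm_comp_le_one hK (norm_comp_le_one hX hP')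
  rw [e]
  refine (norm_add_le _ _).trans ((add_le_add_right (norm_add_le _ _) _).trans ?_)
  simp only [norm_smul, Complex.norm_real, Real.norm_of_nonneg hα, Real.norm_of_nonneg hβ,
    Real.norm_of_nonneg hα', Real.norm_of_nonneg hβ']
  have b1 := mul_le_of_le_one_right hα n1
  have b2 := mul_le_mul_of_nonneg_left (mul_le_of_le_one_right hα' n2) hβ
  have b3 := mul_le_mul_of_nonneg_left (mul_le_mul_of_nonneg_left hq hβ') hβ
  have e1 : α' = 1 - β' := by linarith
  have e2 : α = 1 - β := by linarith
  calc _ ≤ α + (β * α' + β * (β' * q)) := add_le_add b1 (add_le_add b2 b3)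
    _ = 1 - β * β' * (1 - q) := by rw [e1, e2]; ring

end Mixture

theorem normSupLtOne_of_le {T : ℂ → L1Pos →L[ℂ] L1Pos} {s : ℂ → ℝ} {b : ℝ} (hb : 0 < b)
    (h : ∀ z : ℂ, 0 ≤ z.re → ‖T z‖ ≤ 1 - b * (1 - s z))
    (hs : ∀ η : ℝ, 0 < η → ∃ c < 1, ∀ z : ℂ, 0 ≤ z.re → η ≤ ‖z‖ → s z ≤ c) : NormSupLtOne T := by
  intro η hη
  obtain ⟨c, hc, hs⟩ := hs η hη
  refine ⟨1 - b * (1 - c), sub_lt_self _ (mul_pos hb (sub_pos.2 hc)), fun z hz hzη => ?_⟩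
  refine (h z hz).trans (sub_le_sub_left (mul_le_mul_of_nonneg_left ?_ hb.le) _)
  linarith [hs z hz hzη]

theorem quadraticBound_of_le {T : ℂ → L1Pos →L[ℂ] L1Pos} {s : ℂ → ℝ} {b : ℝ} (hb : 0 < b)
    (h : ∀ z : ℂ, 0 ≤ z.re → ‖T z‖ ≤ 1 - b * (1 - s z))
    (hs : ∃ c : ℝ, 0 < c ∧ ∀ᶠ z in 𝓝[{z : ℂ | 0 ≤ z.re}] 0, s z ≤ 1 - c * |z.im| ^ 2) :
    QuadraticBound T := by
  obtain ⟨c, hc, hs⟩ := hs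
  refine ⟨b * c, mul_pos hb hc, ?_⟩
  filter_upwards [hs, self_mem_nhdsWithin] with z h1 hz
  refine (h z hz).trans (sub_le_sub_left ?_ _)
  rw [mul_assoc]
  exact mul_le_mul_of_nonneg_left (by linarith) hb.le

/-- The inverse is `(1 + T)(1 - T²)⁻¹`; the numerator `2` bounds `‖1 + T‖`, and the rest is the
Neumann series of `T²`. -/
theorem isUnit_one_sub_of_sq {T : L1Pos →L[ℂ] L1Pos} (hT : ‖T‖ ≤ 1) {c : ℝ} (hc : c < 1)
    (h : ‖T ^ 2‖ ≤ c) : IsUnit (1 - T) ∧ ‖Ring.inverse (1 - T)‖ ≤ 2 / (1 - c) := by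
  have hlt : ‖T ^ 2‖ < 1 := h.trans_lt hc
  have h1 : ‖(1 : L1Pos →L[ℂ] L1Pos)‖ ≤ 1 := ContinuousLinearMap.norm_id_le
  have hu : IsUnit (1 - T ^ 2) := isUnit_one_sub_of_norm_lt_one hlt
  have e1 : (1 - T) * (1 + T) = 1 - T ^ 2 := by noncomm_ring
  have e2 : (1 + T) * (1 - T) = 1 - T ^ 2 := by noncomm_ring
  have hu' : IsUnit (1 - T) := by
    rw [← e1] at hu
    exact ((show Commute (1 - T) (1 + T) from e1.trans e2.symm).isUnit_mul_iff.1 hu).1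
  refine ⟨hu', ?_⟩
  have hX : (1 - T) * ((1 + T) * Ring.inverse (1 - T ^ 2)) = 1 := by
    rw [← mul_assoc, e1, Ring.mul_inverse_cancel _ hu]
  have hinv : Ring.inverse (1 - T) = (1 + T) * Ring.inverse (1 - T ^ 2) := by
    have := congrArg (Ring.inverse (1 - T) * ·) hX
    simp only [← mul_assoc, Ring.inverse_mul_cancel _ hu', one_mul, mul_one] at this
    exact this.symm
  have hn : ‖Ring.inverse (1 - T ^ 2)‖ ≤ (1 - c)⁻¹ := by
    rw [NormedRing.inverse_one_sub _ hlt]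
    refine (tsum_geometric_le_of_norm_lt_one _ hlt).trans ?_
    have : (1 - ‖T ^ 2‖)⁻¹ ≤ (1 - c)⁻¹ := inv_anti₀ (by linarith) (by linarith)
    linarith
  rw [hinv, div_eq_mul_inv]
  refine (norm_mul_le _ _).trans (mul_le_mul ?_ hn (norm_nonneg _) zero_le_two)
  exact (norm_add_le _ _).trans (by linarith)

theorem NormSupLtOne.sq {T : ℂ → L1Pos →L[ℂ] L1Pos} (hT : ∀ z : ℂ, 0 ≤ z.re → ‖T z‖ ≤ 1)
    (h : NormSupLtOne T) : NormSupLtOne fun z => T z ^ 2 := by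
  intro η hη
  obtain ⟨c, hc, h⟩ := h η hη
  refine ⟨c, hc, fun z hz hzη => ?_⟩
  simp only [pow_two]
  exact (norm_mul_le _ _).trans ((mul_le_of_le_one_left (norm_nonneg _) (hT z hz)).trans (h z hz hzη))

theorem QuadraticBound.sq {T : ℂ → L1Pos →L[ℂ] L1Pos} (hT : ∀ z : ℂ, 0 ≤ z.re → ‖T z‖ ≤ 1)
    (h : QuadraticBound T) : QuadraticBound fun z => T z ^ 2 := by
  obtain ⟨c, hc, h⟩ := h
  refine ⟨c, hc, ?_⟩
  filter_upwards [h, self_mem_nhdsWithin] with z h1 hz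
  rw [pow_two]
  exact (norm_mul_le _ _).trans ((mul_le_of_le_one_left (norm_nonneg _) (hT z hz)).trans h1)

theorem NormSupLtOne.resolventBounded {T : ℂ → L1Pos →L[ℂ] L1Pos}
    (hT : ∀ z : ℂ, 0 ≤ z.re → ‖T z‖ ≤ 1) (h : NormSupLtOne fun z => T z ^ 2) :
    ResolventBounded T := by
  intro η hη
  obtain ⟨c, hc, h⟩ := h η hη
  exact ⟨2 / (1 - c), fun z hz hzη => isUnit_one_sub_of_sq (hT z hz) hc (h z hz hzη)⟩

theorem QuadraticBound.resolventQuadratic {T : ℂ → L1Pos →L[ℂ] L1Pos}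
    (hT : ∀ z : ℂ, 0 ≤ z.re → ‖T z‖ ≤ 1) (h : QuadraticBound fun z => T z ^ 2)
    (h' : ResolventBounded T) : ResolventQuadratic T := by
  obtain ⟨c, hc, h⟩ := h
  refine ⟨2 / c, ?_⟩
  have hmono : 𝓝[{z : ℂ | 0 ≤ z.re ∧ z ≠ 0}] (0 : ℂ) ≤ 𝓝[{z : ℂ | 0 ≤ z.re}] 0 :=
    nhdsWithin_mono _ fun z hz => hz.1
  filter_upwards [hmono h, self_mem_nhdsWithin] with z h1 hz
  -- Invertibility is taken from here because the quadratic bound is void when `Im z = 0`.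
  obtain ⟨C, hC⟩ := h' ‖z‖ (norm_pos_iff.2 hz.2)
  refine ⟨(hC z hz.1 le_rfl).1, fun hy => ?_⟩
  have hpos : 0 < c * |z.im| ^ 2 := mul_pos hc (pow_pos (abs_pos.2 hy) 2)
  have := (isUnit_one_sub_of_sq (hT z hz.1) (sub_lt_self _ hpos) h1).2
  rwa [sub_sub_cancel, ← div_div] at this

theorem norm_G_le_one {a : ℝ} (ha : 0 ≤ a) {A : L1Neg →L[ℂ] L1Pos} {B : L1Pos →L[ℂ] L1Neg}
    (hA : ‖A‖ ≤ 1) (hB : ‖B‖ ≤ 1) {z : ℂ} (hz : 0 ≤ z.re) : ‖G a A B z‖ ≤ 1 :=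
  norm_comp_le_one hA (norm_comp_le_one (norm_expMul_le_one ha hz _)
    (norm_comp_le_one hB (norm_expMul_le_one ha hz _)))

theorem sq_apply (T : L1Pos →L[ℂ] L1Pos) (f : L1Pos) : (T ^ 2) f = T (T f) := by
  rw [pow_two]
  rfl

theorem norm_G_le {a : ℝ} (ha : 0 ≤ a) {α₁ α₂ β₁ β₂ : ℝ} (hα₁ : 0 ≤ α₁) (hα₂ : 0 ≤ α₂)
    (hβ₁ : 0 ≤ β₁) (hβ₂ : 0 ≤ β₂) (h₁ : α₁ + β₁ = 1) (h₂ : α₂ + β₂ = 1)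
    {K₁ : L1Neg →L[ℂ] L1Pos} {K₂ : L1Pos →L[ℂ] L1Neg} (hK₁ : IsStochastic K₁)
    (hK₂ : IsStochastic K₂) {z : ℂ} (hz : 0 ≤ z.re) :
    ‖G a (O₁ α₁ β₁ K₁) (O₂ α₂ β₂ K₂) z‖ ≤
      1 - β₁ * β₂ * (1 - ‖K₁ ∘L expMul a z μNeg ∘L K₂‖) := by
  have e : G a (O₁ α₁ β₁ K₁) (O₂ α₂ β₂ K₂) z =
      (O₁ α₁ β₁ K₁ ∘L expMul a z μNeg ∘L O₂ α₂ β₂ K₂) ∘L expMul a z μPos := by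
    ext1 f
    simp only [G, ContinuousLinearMap.comp_apply]
  rw [e, O₁, O₂]
  refine (ContinuousLinearMap.opNorm_comp_le _ _).trans ((mul_le_of_le_one_right (norm_nonneg _)
    (norm_expMul_le_one ha hz _)).trans ?_)
  exact norm_mixture_comp_mixture_le hα₁ hβ₁ hα₂ hβ₂ h₁ h₂ isStochastic_R₁.norm_le_one
    hK₁.norm_le_one (norm_expMul_le_one ha hz _) isStochastic_R₂.norm_le_one hK₂.norm_le_one le_rfl

/-- Between two diffuse reflections the particle crosses twice with a specular reflection in
between. As `R₂` commutes with the even phase factor, the crossings merge into one with `2a`. -/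
theorem norm_G_sq_le_left {a : ℝ} (ha : 0 ≤ a) {α₁ β₁ : ℝ} (hα₁ : 0 ≤ α₁)
    (hβ₁ : 0 ≤ β₁) (h₁ : α₁ + β₁ = 1) {K₁ : L1Neg →L[ℂ] L1Pos} (hK₁ : IsStochastic K₁)
    {z : ℂ} (hz : 0 ≤ z.re) :
    ‖G a (O₁ α₁ β₁ K₁) R₂ z ^ 2‖ ≤
      1 - β₁ * β₁ * (1 - ‖K₁ ∘L expMul (2 * a) z μNeg ∘L R₂ ∘L K₁‖) := by
  set X := expMul a z μNeg ∘L R₂ ∘L expMul a z μPos with hX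
  have hX1 : ‖X‖ ≤ 1 := norm_comp_le_one (norm_expMul_le_one ha hz _)
    (norm_comp_le_one isStochastic_R₂.norm_le_one (norm_expMul_le_one ha hz _))
  have e : G a (O₁ α₁ β₁ K₁) R₂ z ^ 2 = (O₁ α₁ β₁ K₁ ∘L X ∘L O₁ α₁ β₁ K₁) ∘L X := by
    ext1 f
    simp only [sq_apply, G, hX, ContinuousLinearMap.comp_apply]
  have e2 : K₁ ∘L X ∘L K₁ = K₁ ∘L expMul (2 * a) z μNeg ∘L R₂ ∘L K₁ := by
    ext1 f
    simp only [hX, ContinuousLinearMap.comp_apply]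
    rw [R₂_expMul ha hz, expMul_expMul ha hz]
  rw [e, O₁]
  refine (ContinuousLinearMap.opNorm_comp_le _ _).trans ((mul_le_of_le_one_right (norm_nonneg _)
    hX1).trans ?_)
  exact norm_mixture_comp_mixture_le hα₁ hβ₁ hα₁ hβ₁ h₁ h₁ isStochastic_R₁.norm_le_one
    hK₁.norm_le_one hX1 isStochastic_R₁.norm_le_one hK₁.norm_le_one (by rw [e2])

theorem norm_G_sq_le_right {a : ℝ} (ha : 0 ≤ a) {α₂ β₂ : ℝ} (hα₂ : 0 ≤ α₂)
    (hβ₂ : 0 ≤ β₂) (h₂ : α₂ + β₂ = 1) {K₂ : L1Pos →L[ℂ] L1Neg} (hK₂ : IsStochastic K₂)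
    {z : ℂ} (hz : 0 ≤ z.re) :
    ‖G a R₁ (O₂ α₂ β₂ K₂) z ^ 2‖ ≤
      1 - β₂ * β₂ * (1 - ‖K₂ ∘L expMul (2 * a) z μPos ∘L R₁ ∘L K₂‖) := by
  set X := expMul a z μPos ∘L R₁ ∘L expMul a z μNeg with hX
  have hX1 : ‖X‖ ≤ 1 := norm_comp_le_one (norm_expMul_le_one ha hz _)
    (norm_comp_le_one isStochastic_R₁.norm_le_one (norm_expMul_le_one ha hz _))
  have e : G a R₁ (O₂ α₂ β₂ K₂) z ^ 2 =
      (R₁ ∘L expMul a z μNeg) ∘L ((O₂ α₂ β₂ K₂ ∘L X ∘L O₂ α₂ β₂ K₂) ∘L expMul a z μPos) := by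
    ext1 f
    simp only [sq_apply, G, hX, ContinuousLinearMap.comp_apply]
  have e2 : K₂ ∘L X ∘L K₂ = K₂ ∘L expMul (2 * a) z μPos ∘L R₁ ∘L K₂ := by
    ext1 f
    simp only [hX, ContinuousLinearMap.comp_apply]
    rw [R₁_expMul ha hz, expMul_expMul ha hz]
  rw [e, O₂]
  refine (ContinuousLinearMap.opNorm_comp_le _ _).trans ((mul_le_of_le_one_left (norm_nonneg _)
    (norm_comp_le_one isStochastic_R₁.norm_le_one (norm_expMul_le_one ha hz _))).trans ?_)
  refine (ContinuousLinearMap.opNorm_comp_le _ _).trans ((mul_le_of_le_one_right (norm_nonneg _)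
    (norm_expMul_le_one ha hz _)).trans ?_)
  exact norm_mixture_comp_mixture_le hα₂ hβ₂ hα₂ hβ₂ h₂ h₂ isStochastic_R₂.norm_le_one
    hK₂.norm_le_one hX1 isStochastic_R₂.norm_le_one hK₂.norm_le_one (by rw [e2])

/-- Case of two partly diffuse walls. -/
theorem bounds_G {a : ℝ} (ha : 0 < a) {α₁ α₂ β₁ β₂ : ℝ} (hα₁ : 0 ≤ α₁) (hα₂ : 0 ≤ α₂)
    (hβ₁ : 0 < β₁) (hβ₂ : 0 < β₂) (h₁ : α₁ + β₁ = 1) (h₂ : α₂ + β₂ = 1)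
    {K₁ : L1Neg →L[ℂ] L1Pos} {K₂ : L1Pos →L[ℂ] L1Neg} (hK₁ : IsStochastic K₁)
    (hK₂ : IsStochastic K₂) (hK₂c : IsCompactOperator K₂) {k₁ : ℝ → ℝ → ℝ}
    (hk₁ : IsKernelOf k₁ K₁) :
    NormSupLtOne (G a (O₁ α₁ β₁ K₁) (O₂ α₂ β₂ K₂)) ∧
      QuadraticBound (G a (O₁ α₁ β₁ K₁) (O₂ α₂ β₂ K₂)) :=
  ⟨normSupLtOne_of_le (mul_pos hβ₁ hβ₂)
    (fun _ hz => norm_G_le ha.le hα₁ hα₂ hβ₁.le hβ₂.le h₁ h₂ hK₁ hK₂ hz)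
    fun _ hη => exists_norm_comp_expMul_comp_le ha (absolutelyContinuous_restrict_volume _)
      ae_abs_le_one_neg hk₁ (kernel_nonneg hk₁ hK₁) hK₁ hK₂ hK₂c hη,
  quadraticBound_of_le (mul_pos hβ₁ hβ₂)
    (fun _ hz => norm_G_le ha.le hα₁ hα₂ hβ₁.le hβ₂.le h₁ h₂ hK₁ hK₂ hz)
    (exists_norm_comp_expMul_comp_le_quadratic ha (absolutelyContinuous_restrict_volume _)
      hk₁ (kernel_nonneg hk₁ hK₁) hK₁ hK₂ hK₂c)⟩

/-- Case of a specular right wall. -/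
theorem bounds_G_sq_left {a : ℝ} (ha : 0 < a) {α₁ β₁ : ℝ} (hα₁ : 0 ≤ α₁) (hβ₁ : 0 < β₁)
    (h₁ : α₁ + β₁ = 1) {K₁ : L1Neg →L[ℂ] L1Pos} (hK₁ : IsStochastic K₁)
    (hK₁c : IsCompactOperator K₁) {k₁ : ℝ → ℝ → ℝ} (hk₁ : IsKernelOf k₁ K₁) :
    NormSupLtOne (fun z => G a (O₁ α₁ β₁ K₁) R₂ z ^ 2) ∧
      QuadraticBound (fun z => G a (O₁ α₁ β₁ K₁) R₂ z ^ 2) :=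
  ⟨normSupLtOne_of_le (mul_pos hβ₁ hβ₁)
    (fun _ hz => norm_G_sq_le_left ha.le hα₁ hβ₁.le h₁ hK₁ hz)
    fun _ hη => exists_norm_comp_expMul_comp_le (by positivity)
      (absolutelyContinuous_restrict_volume _) ae_abs_le_one_neg hk₁ (kernel_nonneg hk₁ hK₁) hK₁
      (isStochastic_R₂.comp hK₁) (hK₁c.clm_comp R₂) hη,
  quadraticBound_of_le (mul_pos hβ₁ hβ₁)
    (fun _ hz => norm_G_sq_le_left ha.le hα₁ hβ₁.le h₁ hK₁ hz)
    (exists_norm_comp_expMul_comp_le_quadratic (by positivity)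
      (absolutelyContinuous_restrict_volume _) hk₁ (kernel_nonneg hk₁ hK₁) hK₁
      (isStochastic_R₂.comp hK₁) (hK₁c.clm_comp R₂))⟩

/-- Case of a specular left wall. -/
theorem bounds_G_sq_right {a : ℝ} (ha : 0 < a) {α₂ β₂ : ℝ} (hα₂ : 0 ≤ α₂) (hβ₂ : 0 < β₂)
    (h₂ : α₂ + β₂ = 1) {K₂ : L1Pos →L[ℂ] L1Neg} (hK₂ : IsStochastic K₂)
    (hK₂c : IsCompactOperator K₂) {k₂ : ℝ → ℝ → ℝ} (hk₂ : IsKernelOf k₂ K₂) :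
    NormSupLtOne (fun z => G a R₁ (O₂ α₂ β₂ K₂) z ^ 2) ∧
      QuadraticBound (fun z => G a R₁ (O₂ α₂ β₂ K₂) z ^ 2) :=
  ⟨normSupLtOne_of_le (mul_pos hβ₂ hβ₂)
    (fun _ hz => norm_G_sq_le_right ha.le hα₂ hβ₂.le h₂ hK₂ hz)
    fun _ hη => exists_norm_comp_expMul_comp_le (by positivity)
      (absolutelyContinuous_restrict_volume _) ae_abs_le_one_pos hk₂ (kernel_nonneg hk₂ hK₂) hK₂
      (isStochastic_R₁.comp hK₂) (hK₂c.clm_comp R₁) hη,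
  quadraticBound_of_le (mul_pos hβ₂ hβ₂)
    (fun _ hz => norm_G_sq_le_right ha.le hα₂ hβ₂.le h₂ hK₂ hz)
    (exists_norm_comp_expMul_comp_le_quadratic (by positivity)
      (absolutelyContinuous_restrict_volume _) hk₂ (kernel_nonneg hk₂ hK₂) hK₂
      (isStochastic_R₁.comp hK₂) (hK₂c.clm_comp R₁))⟩

end SlabTransport

open SlabTransport in
theorem mainTheorem2
    (a : ℝ) (ha : 0 < a) (α₁ α₂ β₁ β₂ : ℝ)
    (hα₁ : 0 ≤ α₁) (hα₂ : 0 ≤ α₂) (hβ₁ : 0 ≤ β₁) (hβ₂ : 0 ≤ β₂)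
    (h₁ : α₁ + β₁ = 1) (h₂ : α₂ + β₂ = 1) (hβ : 0 < β₁ + β₂)
    (K₁ : L1Neg →L[ℂ] L1Pos) (K₂ : L1Pos →L[ℂ] L1Neg)
    (hK₁ : IsStochastic K₁) (hK₂ : IsStochastic K₂)
    (hK₁c : IsCompactOperator K₁) (hK₂c : IsCompactOperator K₂) :
    -- both boundary conditions are partly diffuse
    (0 < β₁ → 0 < β₂ →
      (∀ k₁ : ℝ → ℝ → ℝ, IsKernelOf k₁ K₁ → (∀ᵐ w ∂μPos, MemLp (k₁ w) ⊤ μNeg) →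
        NormSupLtOne (G a (O₁ α₁ β₁ K₁) (O₂ α₂ β₂ K₂)) ∧
        ResolventBounded (G a (O₁ α₁ β₁ K₁) (O₂ α₂ β₂ K₂))) ∧
      (∀ k₁ k₂ : ℝ → ℝ → ℝ, IsKernelOf k₁ K₁ → IsKernelOf k₂ K₂ →
        ContinuousOn (Function.uncurry k₁) (Set.Ioo 0 1 ×ˢ Set.Ioo (-1) 0) →
        ContinuousOn (Function.uncurry k₂) (Set.Ioo (-1) 0 ×ˢ Set.Ioo 0 1) →
        IsBoundedInvSq K₁ K₂ →
        QuadraticBound (G a (O₁ α₁ β₁ K₁) (O₂ α₂ β₂ K₂)) ∧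
        ResolventQuadratic (G a (O₁ α₁ β₁ K₁) (O₂ α₂ β₂ K₂)))) ∧
    -- only the boundary condition at the left wall is partly diffuse
    (0 < β₁ → β₂ = 0 →
      (∀ k₁ : ℝ → ℝ → ℝ, IsKernelOf k₁ K₁ → (∀ᵐ w ∂μPos, MemLp (k₁ w) ⊤ μNeg) →
        NormSupLtOne (fun z => G a (O₁ α₁ β₁ K₁) (O₂ α₂ β₂ K₂) z ^ 2) ∧
        ResolventBounded (G a (O₁ α₁ β₁ K₁) (O₂ α₂ β₂ K₂))) ∧
      (∀ k₁ : ℝ → ℝ → ℝ, IsKernelOf k₁ K₁ →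
        ContinuousOn (Function.uncurry k₁) (Set.Ioo 0 1 ×ˢ Set.Ioo (-1) 0) →
        IsBoundedInvSq K₁ (R₂ ∘L K₁) →
        QuadraticBound (fun z => G a (O₁ α₁ β₁ K₁) (O₂ α₂ β₂ K₂) z ^ 2) ∧
        ResolventQuadratic (G a (O₁ α₁ β₁ K₁) (O₂ α₂ β₂ K₂)))) ∧
    -- only the boundary condition at the right wall is partly diffuse
    (β₁ = 0 → 0 < β₂ →
      (∀ k₂ : ℝ → ℝ → ℝ, IsKernelOf k₂ K₂ → (∀ᵐ w ∂μNeg, MemLp (k₂ w) ⊤ μPos) →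
        NormSupLtOne (fun z => G a (O₁ α₁ β₁ K₁) (O₂ α₂ β₂ K₂) z ^ 2) ∧
        ResolventBounded (G a (O₁ α₁ β₁ K₁) (O₂ α₂ β₂ K₂))) ∧
      (∀ k₂ : ℝ → ℝ → ℝ, IsKernelOf k₂ K₂ →
        ContinuousOn (Function.uncurry k₂) (Set.Ioo (-1) 0 ×ˢ Set.Ioo 0 1) →
        IsBoundedInvSq K₂ (R₁ ∘L K₂) →
        QuadraticBound (fun z => G a (O₁ α₁ β₁ K₁) (O₂ α₂ β₂ K₂) z ^ 2) ∧
        ResolventQuadratic (G a (O₁ α₁ β₁ K₁) (O₂ α₂ β₂ K₂)))) := by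
  have hT : ∀ z : ℂ, 0 ≤ z.re → ‖G a (O₁ α₁ β₁ K₁) (O₂ α₂ β₂ K₂) z‖ ≤ 1 := fun z hz =>
    norm_G_le_one ha.le
      (norm_mixture_le_one hα₁ hβ₁ h₁ isStochastic_R₁.norm_le_one hK₁.norm_le_one)
      (norm_mixture_le_one hα₂ hβ₂ h₂ isStochastic_R₂.norm_le_one hK₂.norm_le_one) hz
  refine ⟨fun p₁ p₂ => ⟨fun k₁ hk₁ _ => ?_, fun k₁ k₂ hk₁ _ _ _ _ => ?_⟩,
    fun p₁ p₂ => ⟨fun k₁ hk₁ _ => ?_, fun k₁ hk₁ _ _ => ?_⟩,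
    fun p₁ p₂ => ⟨fun k₂ hk₂ _ => ?_, fun k₂ hk₂ _ _ => ?_⟩⟩
  · have h := bounds_G ha hα₁ hα₂ p₁ p₂ h₁ h₂ hK₁ hK₂ hK₂c hk₁
    exact ⟨h.1, (h.1.sq hT).resolventBounded hT⟩
  · have h := bounds_G ha hα₁ hα₂ p₁ p₂ h₁ h₂ hK₁ hK₂ hK₂c hk₁
    exact ⟨h.2, (h.2.sq hT).resolventQuadratic hT ((h.1.sq hT).resolventBounded hT)⟩
  -- A wall with `β = 0` is purely reflecting. The first alternative treats `β₂ = 0`, the second `β₁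
  -- = 0`.
  all_goals
    first
    | have e : O₂ α₂ β₂ K₂ = R₂ := by
        rw [O₂, p₂, (by linarith : α₂ = 1)]
        simp
      rw [e] at hT ⊢
      have h := bounds_G_sq_left ha hα₁ p₁ h₁ hK₁ hK₁c hk₁
    | have e : O₁ α₁ β₁ K₁ = R₁ := by
        rw [O₁, p₁, (by linarith : α₁ = 1)]
        simp
      rw [e] at hT ⊢
      have h := bounds_G_sq_right ha hα₂ p₂ h₂ hK₂ hK₂c hk₂
  · exact ⟨h.1, h.1.resolventBounded hT⟩
  · exact ⟨h.2, h.2.resolventQuadratic hT (h.1.resolventBounded hT)⟩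
  · exact ⟨h.1, h.1.resolventBounded hT⟩
  · exact ⟨h.2, h.2.resolventQuadratic hT (h.1.resolventBounded hT)⟩
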